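/- For real $c<-2$ let $f_c(z)=z^2+c$, let $J_c$ be its Julia set (a Cantor set contained in the real line), and let $L_c$ be the Ruelle operator $$L_cg(x)=\sum_{y:\,f_c(y)=x}\frac{g(y)}{(f_c'(y))^{2}},\qquad x\in J_c,$$ acting on continuous complex-valued functions on $J_c$. Call a Borel probability measure $\sigma$ on $\mathbb R$ a Gibbs state of $f_c$ for the weight $(f_c')^{-2}$ if $\sigma=h\nu$, where $h$ is a positive continuous function on $J_c$ with $L_ch=\Lambda h$, $\nu$ is a nonzero finite Borel measure carried by $J_c$ with $L_c^*\nu=\Lambda\nu$, and $\Lambda>0$ is a simple eigenvalue of $L_c$ that is strictly larger than the modulus of every other eigenvalue of $L_c$. Proposition 1. For every $c<-2$ there is exactly one Gibbs state $\sigma_c$ of $f_c$ for the weight $(f_c')^{-2}$. As $c\to-2$ with $c<-2$, the measures $\sigma_c$ converge weakly to the measure $\sigma_{-2}$, the image of Lebesgue measure on $[0,1]$ under $t\mapsto 2\cos\pi t$, which is absolutely continuous with density $\dfrac{1}{\pi\sqrt{4-x^2}}$ on $[-2,2]$. -/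

import Mathlib

open MeasureTheory Filter Topology

noncomputable section

namespace QuadraticGibbs

/-- The filled Julia set of `z ↦ z ^ 2 + c` : the points of the complex plane with a bounded
forward orbit. -/
def filledJuliaSet (c : ℝ) : Set ℂ :=
  {z : ℂ | Bornology.IsBounded (Set.range fun n : ℕ => (fun w : ℂ => w ^ 2 + (c : ℂ))^[n] z)}

/-- The Julia set of the polynomial `z ↦ z ^ 2 + c`, the boundary of the filled Julia set. -/
def juliaSet (c : ℝ) : Set ℂ := frontier (filledJuliaSet c)

/-- The Julia set as a set of real numbers. (For `c < -2` the whole Julia set lies on the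
real line.) -/
def realJuliaSet (c : ℝ) : Set ℝ := {x : ℝ | (x : ℂ) ∈ juliaSet c}

/-- The map `f_c` on the real line. -/
def quad (c : ℝ) (x : ℝ) : ℝ := x ^ 2 + c

/-- The Ruelle operator `L_c g (x) = ∑_{f_c(y) = x} g(y) / f_c'(y) ^ 2`, on real or complex
valued functions. The fibres of `f_c` are finite. -/
def ruelle {E : Type*} [AddCommGroup E] [Module ℝ E] (c : ℝ) (g : ℝ → E) (x : ℝ) : E :=
  ∑ᶠ y ∈ quad c ⁻¹' {x}, ((deriv (quad c) y) ^ 2)⁻¹ • g y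

/-- `g` is an eigenfunction of `L_c`, acting on the continuous complex functions on the Julia
set, for the eigenvalue `κ`. Only the values of `g` on the Julia set matter. -/
structure IsEigenfunction (c : ℝ) (κ : ℂ) (g : ℝ → ℂ) : Prop where
  continuousOn : ContinuousOn g (realJuliaSet c)
  ne_zero : ∃ x ∈ realJuliaSet c, g x ≠ 0
  eigen : ∀ x ∈ realJuliaSet c, ruelle c g x = κ * g x

/-- `Λ` is a positive eigenvalue of `L_c` which is simple (its generalized eigenspace is
one-dimensional: `proportional` and `semisimple`) and strictly larger than the modulus of every
other eigenvalue. -/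
structure IsLeadingEigenvalue (c Λ : ℝ) : Prop where
  pos : 0 < Λ
  isEigenvalue : ∃ g, IsEigenfunction c (Λ : ℂ) g
  proportional : ∀ g₁ g₂, IsEigenfunction c (Λ : ℂ) g₁ → IsEigenfunction c (Λ : ℂ) g₂ →
    ∃ a : ℂ, ∀ x ∈ realJuliaSet c, g₂ x = a * g₁ x
  semisimple : ∀ g : ℝ → ℂ, ContinuousOn g (realJuliaSet c) →
    (∀ x ∈ realJuliaSet c, ruelle c (fun y => ruelle c g y - (Λ : ℂ) * g y) x
      = (Λ : ℂ) * (ruelle c g x - (Λ : ℂ) * g x)) →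
    ∀ x ∈ realJuliaSet c, ruelle c g x = (Λ : ℂ) * g x
  dominant : ∀ (κ : ℂ) (g : ℝ → ℂ), IsEigenfunction c κ g → κ ≠ (Λ : ℂ) → ‖κ‖ < Λ

/-- `h` is a positive continuous function on the Julia set with `L_c h = Λ h`. -/
structure IsPositiveEigenfunction (c Λ : ℝ) (h : ℝ → ℝ) : Prop where
  continuousOn : ContinuousOn h (realJuliaSet c)
  pos : ∀ x ∈ realJuliaSet c, 0 < h x
  eigen : ∀ x ∈ realJuliaSet c, ruelle c h x = Λ * h x

/-- `ν` is a nonzero finite Borel measure on the Julia set with `L_c^* ν = Λ ν`. -/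
structure IsEigenmeasure (c Λ : ℝ) (ν : Measure ℝ) : Prop where
  finite : IsFiniteMeasure ν
  ne_zero : ν ≠ 0
  supported : ν (realJuliaSet c)ᶜ = 0
  eigen : ∀ g : ℝ → ℝ, ContinuousOn g (realJuliaSet c) →
    ∫ x, ruelle c g x ∂ν = Λ * ∫ x, g x ∂ν

/-- `σ` is a Gibbs state of `f_c` for the weight `(f_c')⁻²` : a probability measure `h ν`, with
`h` and `ν` eigenvectors of `L_c` and `L_c^*` for the leading eigenvalue. -/
def IsGibbsState (c : ℝ) (σ : ProbabilityMeasure ℝ) : Prop :=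
  ∃ (Λ : ℝ) (h : ℝ → ℝ) (ν : Measure ℝ),
    IsLeadingEigenvalue c Λ ∧ IsPositiveEigenfunction c Λ h ∧ IsEigenmeasure c Λ ν ∧
      (σ : Measure ℝ) = ν.withDensity fun x => ENNReal.ofReal (h x)

/-- The arcsine measure `σ_{-2}` : the image of Lebesgue measure on `[0, 1]` under
`t ↦ 2 cos (π t)`. -/
def arcsineMeasure : ProbabilityMeasure ℝ :=
  ⟨(volume.restrict (Set.Icc (0 : ℝ) 1)).map fun t => 2 * Real.cos (Real.pi * t), by
    have : IsProbabilityMeasure (volume.restrict (Set.Icc (0 : ℝ) 1)) := ⟨by simp⟩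
    exact Measure.isProbabilityMeasure_map (by fun_prop)⟩

end QuadraticGibbs

end

/-!
The proof is elementary because the Ruelle operator `L_c` can be diagonalized at the top by hand.

* *Eigenfunction.* The weight `(f_c')⁻²` equals `1 / (4 (x - c))` at both preimages of `x`, and `L_c`
  maps a partial fraction `1 / (z - ·)` to a combination of `1 / (f_c(z) - ·)` and `1 / (· - c)`.
  Starting from the pole `c` this gives a positive eigenfunction `h` (`eigfun`) with poles along the
  critical orbit; its eigenvalue is `1 / l`, where `l` is the positive zero of
  `1 + ∑ l ^ n / (f_c^n)'(c)` (`exists_hasSum_coef`, `ruelle_eigfun`).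
* *Leading eigenvalue.* After division by `h` the eigenvalue equation says that the value at `x`
  is, up to a factor, a weighted mean of the values at the two preimages. The maximum principle and
  the density of the backward orbits (`exists_seq_tendsto`) force an eigenfunction for an
  eigenvalue of modulus at least `1 / l` to be a multiple of `h` (`eq_of_isEigenfunction`). Backward
  orbits are dense because in the metric `|dx| / √(β² - x²)` on `[-β, β]`, with `β` the larger fixed
  point, both inverse branches contract by the factor `1 / 2` (`angleDist_root_le`).
* *Eigenmeasure.* It exists by a Krylov–Bogoliubov argument for the normalized operator
  (`exists_invariant_measure`). It is unique up to a factor because `L_c` maps `x ^ (2 k + 1)` to `0`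
  and `x ^ (2 k + 2)` to `(x - c) ^ k / 2`, so that the eigenvalue equation determines all moments
  (`IsEigenmeasure.integral_polynomial`).
* *Limit.* The Gibbs state is invariant under the mean over the preimages with weights proportional
  to `h`. The explicit form of `h` shows that the positive branch has weight at most `1 / 2`, so that
  the states do not concentrate at `β` (`IsExplicitGibbs.integral_posOrbit_le`), and that away from
  `β` both weights tend to `1 / 2` as `c → -2` (`eigfun_neg_sub_le`, `tendsto_asymBound`). Hence
  replacing the weighted mean by the plain one costs nothing in the limit. Iterated plain means are
  nearly constant by the contraction property, depend continuously on `c`, and for `c = -2` preserve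
  the arcsine measure (`integral_halfMean_arcsineMeasure`).
-/

namespace QuadraticGibbs

/-! ### The Julia set as a set of non-escaping real points -/

/-- The larger fixed point `β` of `f_c`; for `c ≤ -2` the points whose orbit leaves `[-β, β]` are
those that escape to infinity. -/
noncomputable def fixPt (c : ℝ) : ℝ := (1 + √(1 - 4 * c)) / 2

lemma fixPt_sq {c : ℝ} (hc : c ≤ -2) : fixPt c ^ 2 + c = fixPt c := by
  have := Real.sq_sqrt (show 0 ≤ 1 - 4 * c by linarith)
  unfold fixPt
  nlinarith

lemma two_le_fixPt {c : ℝ} (hc : c ≤ -2) : 2 ≤ fixPt c := by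
  have : (3 : ℝ) ≤ √(1 - 4 * c) := Real.le_sqrt_of_sq_le (by linarith)
  unfold fixPt
  linarith

lemma two_lt_fixPt {c : ℝ} (hc : c < -2) : 2 < fixPt c := by
  have : (3 : ℝ) < √(1 - 4 * c) := Real.lt_sqrt_of_sq_lt (by linarith)
  unfold fixPt
  linarith

lemma lt_neg_fixPt {c : ℝ} (hc : c < -2) : c < -fixPt c := by
  have h1 := fixPt_sq hc.le
  have h2 := two_lt_fixPt hc
  nlinarith

lemma le_neg_fixPt {c : ℝ} (hc : c ≤ -2) : c ≤ -fixPt c := by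
  have h1 := fixPt_sq hc
  have h2 := two_le_fixPt hc
  nlinarith

/-- The non-negative branch of the inverse of `f_c`; the other one is `-root c`. -/
noncomputable def root (c x : ℝ) : ℝ := √(x - c)

lemma root_nonneg (c x : ℝ) : 0 ≤ root c x := Real.sqrt_nonneg _

lemma root_sq {c x : ℝ} (hx : c ≤ x) : root c x ^ 2 = x - c := Real.sq_sqrt (by linarith)

lemma root_pos {c x : ℝ} (hx : c < x) : 0 < root c x := Real.sqrt_pos.2 (by linarith)

lemma continuous_root (c : ℝ) : Continuous (root c) := by unfold root; fun_prop

lemma root_quad (c x : ℝ) : root c (quad c x) = |x| := by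
  simp [root, quad, Real.sqrt_sq_eq_abs]

lemma quad_root {c x : ℝ} (hx : c ≤ x) : quad c (root c x) = x := by
  simp [quad, root_sq hx]

lemma quad_neg_root {c x : ℝ} (hx : c ≤ x) : quad c (-root c x) = x := by
  simp [quad, root_sq hx]

lemma root_le_fixPt {c x : ℝ} (hc : c ≤ -2) (hx : x ≤ fixPt c) : root c x ≤ fixPt c := by
  have h1 := fixPt_sq hc
  have h2 := two_le_fixPt hc
  exact Real.sqrt_le_iff.2 ⟨by linarith, by linarith⟩

/-- The real points whose orbit never leaves `[-β, β]`. -/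
def trapped (c : ℝ) : Set ℝ := {x | ∀ n : ℕ, |(quad c)^[n] x| ≤ fixPt c}

lemma abs_le_of_mem_trapped {c x : ℝ} (hx : x ∈ trapped c) : |x| ≤ fixPt c := hx 0

lemma lt_of_abs_le {c x : ℝ} (hc : c < -2) (hx : |x| ≤ fixPt c) : c < x :=
  (lt_neg_fixPt hc).trans_le (abs_le.1 hx).1

lemma quad_mem_trapped {c x : ℝ} (hx : x ∈ trapped c) : quad c x ∈ trapped c := fun n => by
  simpa [Function.iterate_succ_apply] using hx (n + 1)

lemma mem_trapped_of_quad {c x : ℝ} (hx : |x| ≤ fixPt c) (h : quad c x ∈ trapped c) :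
    x ∈ trapped c := fun n => by
  cases n with
  | zero => exact hx
  | succ n => simpa [Function.iterate_succ_apply] using h n

lemma root_mem_trapped {c x : ℝ} (hc : c < -2) (hx : x ∈ trapped c) : root c x ∈ trapped c := by
  have h0 := abs_le_of_mem_trapped hx
  refine mem_trapped_of_quad ?_ (by rwa [quad_root (lt_of_abs_le hc h0).le])
  rw [abs_of_nonneg (root_nonneg _ _)]
  exact root_le_fixPt hc.le (abs_le.1 h0).2

lemma neg_mem_trapped {c x : ℝ} (hx : x ∈ trapped c) : -x ∈ trapped c :=
  mem_trapped_of_quad (by simpa using abs_le_of_mem_trapped hx)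
    (by simpa [quad] using quad_mem_trapped hx)

lemma neg_root_mem_trapped {c x : ℝ} (hc : c < -2) (hx : x ∈ trapped c) :
    -root c x ∈ trapped c :=
  neg_mem_trapped (root_mem_trapped hc hx)

lemma fixPt_mem_trapped {c : ℝ} (hc : c ≤ -2) : fixPt c ∈ trapped c := fun n => by
  rw [Function.iterate_fixed (by simpa [quad] using fixPt_sq hc),
    abs_of_nonneg (by linarith [two_le_fixPt hc])]

lemma continuous_quad (c : ℝ) : Continuous (quad c) := by unfold quad; fun_prop

lemma isClosed_trapped (c : ℝ) : IsClosed (trapped c) := by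
  have : trapped c = ⋂ n : ℕ, {x | |(quad c)^[n] x| ≤ fixPt c} := by
    ext; simp [trapped]
  rw [this]
  exact isClosed_iInter fun n =>
    isClosed_le ((continuous_quad c).iterate n).abs continuous_const

lemma trapped_subset_Icc (c : ℝ) : trapped c ⊆ Set.Icc (-fixPt c) (fixPt c) := fun _ hx =>
  abs_le.1 (abs_le_of_mem_trapped hx)

lemma isCompact_trapped (c : ℝ) : IsCompact (trapped c) :=
  isCompact_Icc.of_isClosed_subset (isClosed_trapped c) (trapped_subset_Icc c)

/-! ### Contraction of the inverse branches in the angular metric -/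

/-- The distance of the angles `θ` in `x = β cos θ`. In this metric, which has the density
`1 / √(β ^ 2 - x ^ 2)`, both inverse branches of `f_c` contract by a factor `1 / 2`. -/
noncomputable def angleDist (c x y : ℝ) : ℝ :=
  |Real.arccos (x / fixPt c) - Real.arccos (y / fixPt c)|

lemma angleDist_le_pi (c x y : ℝ) : angleDist c x y ≤ Real.pi := by
  have h1 := Real.arccos_nonneg (x / fixPt c)
  have h2 := Real.arccos_nonneg (y / fixPt c)
  have h3 := Real.arccos_le_pi (x / fixPt c)
  have h4 := Real.arccos_le_pi (y / fixPt c)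
  exact abs_le.2 ⟨by linarith, by linarith⟩

lemma angleDist_neg (c x y : ℝ) : angleDist c (-x) (-y) = angleDist c x y := by
  unfold angleDist
  rw [neg_div, neg_div, Real.arccos_neg, Real.arccos_neg, ← abs_neg]
  congr 1
  ring

lemma mul_cos_arccos_div {c x : ℝ} (hc : c ≤ -2) (hx : |x| ≤ fixPt c) :
    fixPt c * Real.cos (Real.arccos (x / fixPt c)) = x := by
  have h2 := two_le_fixPt hc
  have := abs_le.1 hx
  rw [Real.cos_arccos]
  · field_simp
  · rw [le_div_iff₀ (by linarith)]; linarith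
  · rw [div_le_iff₀ (by linarith)]; linarith

lemma abs_sub_le_angleDist {c x y : ℝ} (hc : c ≤ -2) (hx : |x| ≤ fixPt c) (hy : |y| ≤ fixPt c) :
    |x - y| ≤ fixPt c * angleDist c x y := by
  have h2 := two_le_fixPt hc
  conv_lhs => rw [← mul_cos_arccos_div hc hx, ← mul_cos_arccos_div hc hy, ← mul_sub, abs_mul,
    abs_of_nonneg (show 0 ≤ fixPt c by linarith)]
  exact mul_le_mul_of_nonneg_left (Real.abs_cos_sub_cos_le _ _) (by linarith)

lemma abs_arcsin_mul_sin_sub_le {k : ℝ} (hk0 : 0 ≤ k) (hk1 : k < 1) (a b : ℝ) :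
    |Real.arcsin (k * Real.sin a) - Real.arcsin (k * Real.sin b)| ≤ |a - b| := by
  have hlt (t : ℝ) : |k * Real.sin t| < 1 := by
    rw [abs_mul, abs_of_nonneg hk0]
    nlinarith [Real.abs_sin_le_one t, abs_nonneg (Real.sin t)]
  have hd (t : ℝ) : HasDerivAt (fun t => Real.arcsin (k * Real.sin t))
      (1 / √(1 - (k * Real.sin t) ^ 2) * (k * Real.cos t)) t :=
    HasDerivAt.comp (h₂ := Real.arcsin) t
      (Real.hasDerivAt_arcsin (abs_lt.1 (hlt t)).1.ne' (abs_lt.1 (hlt t)).2.ne)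
      ((Real.hasDerivAt_sin t).const_mul k)
  have hL : LipschitzWith 1 (fun t => Real.arcsin (k * Real.sin t)) := by
    refine lipschitzWith_of_nnnorm_deriv_le (fun t => (hd t).differentiableAt) fun t => ?_
    rw [(hd t).deriv, ← NNReal.coe_le_coe, coe_nnnorm, Real.norm_eq_abs, abs_mul, abs_div, abs_one,
      abs_of_nonneg (Real.sqrt_nonneg _), one_div, NNReal.coe_one]
    have hpos : 0 < 1 - (k * Real.sin t) ^ 2 := by
      have := (sq_lt_one_iff_abs_lt_one _).2 (hlt t)
      linarith
    rw [inv_mul_le_iff₀ (Real.sqrt_pos.2 hpos), mul_one]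
    refine Real.abs_le_sqrt ?_
    have h1 : (k * Real.cos t) ^ 2 + (k * Real.sin t) ^ 2 = k ^ 2 := by
      linear_combination k ^ 2 * Real.sin_sq_add_cos_sq t
    have h2 : k ^ 2 ≤ 1 := pow_le_one₀ hk0 hk1.le
    linarith
  simpa [Real.dist_eq] using hL.dist_le_mul a b

lemma arccos_root {c x : ℝ} (hc : c ≤ -2) (hx : |x| ≤ fixPt c) :
    Real.arccos (root c x / fixPt c) =
      Real.arcsin (√(2 / fixPt c) * Real.sin (Real.arccos (x / fixPt c) / 2)) := by
  set θ := Real.arccos (x / fixPt c) with hθ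
  have h1 := fixPt_sq hc
  have h2 := two_le_fixPt hc
  have hx' : fixPt c * Real.cos θ = x := mul_cos_arccos_div hc hx
  have hθ0 : 0 ≤ θ := Real.arccos_nonneg _
  have hθ1 : θ ≤ Real.pi := Real.arccos_le_pi _
  have hs : 0 ≤ Real.sin (θ / 2) := Real.sin_nonneg_of_nonneg_of_le_pi (by linarith) (by linarith)
  have hcos : Real.cos θ = 1 - 2 * Real.sin (θ / 2) ^ 2 := by
    have := Real.cos_two_mul (θ / 2)
    rw [mul_div_cancel₀ _ two_ne_zero] at this
    have h3 := Real.sin_sq_add_cos_sq (θ / 2)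
    linarith
  rw [Real.arccos_eq_arcsin (div_nonneg (root_nonneg _ _) (by linarith))]
  congr 1
  rw [div_pow, root_sq (by linarith [le_neg_fixPt hc, (abs_le.1 hx).1]), ← Real.sqrt_sq hs,
    ← Real.sqrt_mul (by positivity)]
  congr 1
  have hne : fixPt c ≠ 0 := by linarith
  rw [← hx', hcos]
  field_simp
  linarith

lemma angleDist_root_le {c x y : ℝ} (hc : c ≤ -2) (hx : |x| ≤ fixPt c) (hy : |y| ≤ fixPt c) :
    angleDist c (root c x) (root c y) ≤ angleDist c x y / 2 := by
  have h2 := two_le_fixPt hc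
  unfold angleDist
  rw [arccos_root hc hx, arccos_root hc hy]
  set a := Real.arccos (x / fixPt c)
  set b := Real.arccos (y / fixPt c)
  have ha0 : 0 ≤ a := Real.arccos_nonneg _
  have ha1 : a ≤ Real.pi := Real.arccos_le_pi _
  have hb0 : 0 ≤ b := Real.arccos_nonneg _
  have hb1 : b ≤ Real.pi := Real.arccos_le_pi _
  have hab : |a - b| / 2 = |a / 2 - b / 2| := by
    rw [← sub_div, abs_div, abs_two]
  have hk1 : √(2 / fixPt c) ≤ 1 := Real.sqrt_le_one.2 (by rw [div_le_one] <;> linarith)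
  rw [hab]
  rcases hk1.lt_or_eq with hk | hk
  · exact abs_arcsin_mul_sin_sub_le (Real.sqrt_nonneg _) hk _ _
  · rw [hk, one_mul, one_mul, Real.arcsin_sin (by linarith) (by linarith),
      Real.arcsin_sin (by linarith) (by linarith)]

/-- Following the itinerary of `x` backwards from an arbitrary point `u` of `[-β, β]` leads to a
point close to `x`. -/
lemma exists_iterate_eq_near {c : ℝ} (hc : c ≤ -2) {u : ℝ} (hu : |u| ≤ fixPt c) (n : ℕ) :
    ∀ x ∈ trapped c, ∃ y, |y| ≤ fixPt c ∧ (quad c)^[n] y = u ∧ (u ∈ trapped c → y ∈ trapped c) ∧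
      angleDist c x y ≤ Real.pi / 2 ^ n := by
  induction n with
  | zero => exact fun x _ => ⟨u, hu, rfl, id, by simpa using angleDist_le_pi c x u⟩
  | succ n ih =>
    intro x hx
    obtain ⟨y, hy, hyu, hyK, hd⟩ := ih _ (quad_mem_trapped hx)
    have hcy : c ≤ y := by linarith [le_neg_fixPt hc, (abs_le.1 hy).1]
    have hr : |root c y| ≤ fixPt c := by
      rw [abs_of_nonneg (root_nonneg _ _)]
      exact root_le_fixPt hc (abs_le.1 hy).2
    have hd' : angleDist c |x| (root c y) ≤ Real.pi / 2 ^ (n + 1) := by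
      rw [← root_quad c x, pow_succ, ← div_div]
      refine (angleDist_root_le hc (abs_le_of_mem_trapped (quad_mem_trapped hx)) hy).trans ?_
      linarith
    rcases le_total 0 x with h0 | h0
    · rw [abs_of_nonneg h0] at hd'
      refine ⟨root c y, hr, ?_, fun h => mem_trapped_of_quad hr ?_, hd'⟩
      · rw [Function.iterate_succ_apply, quad_root hcy, hyu]
      · rw [quad_root hcy]; exact hyK h
    · rw [abs_of_nonpos h0] at hd'
      refine ⟨-root c y, by rwa [abs_neg], ?_, fun h => mem_trapped_of_quad (by rwa [abs_neg]) ?_,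
        ?_⟩
      · rw [Function.iterate_succ_apply, quad_neg_root hcy, hyu]
      · rw [quad_neg_root hcy]; exact hyK h
      · rw [← angleDist_neg, neg_neg]; exact hd'

lemma exists_seq_tendsto {c : ℝ} (hc : c ≤ -2) {u x : ℝ} (hu : |u| ≤ fixPt c)
    (hx : x ∈ trapped c) :
    ∃ y : ℕ → ℝ, (∀ n, (quad c)^[n] (y n) = u) ∧ (u ∈ trapped c → ∀ n, y n ∈ trapped c) ∧
      Tendsto y atTop (𝓝 x) := by
  choose y h1 h2 h3 h4 using fun n => exists_iterate_eq_near hc hu n x hx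
  refine ⟨y, h2, fun h n => h3 n h, ?_⟩
  have hlim : Tendsto (fun n : ℕ => fixPt c * (Real.pi * (1 / 2) ^ n)) atTop (𝓝 0) := by
    simpa using ((tendsto_pow_atTop_nhds_zero_of_lt_one (r := (1 / 2 : ℝ)) (by norm_num)
      (by norm_num)).const_mul Real.pi).const_mul (fixPt c)
  rw [tendsto_iff_dist_tendsto_zero]
  refine squeeze_zero (fun _ => dist_nonneg) (fun n => ?_) hlim
  rw [dist_comm, Real.dist_eq]
  refine (abs_sub_le_angleDist hc (abs_le_of_mem_trapped hx) (h1 n)).trans ?_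
  refine mul_le_mul_of_nonneg_left ((h4 n).trans_eq ?_) (by linarith [two_le_fixPt hc])
  rw [div_pow, one_pow]; ring

/-! ### Identification of the Julia set -/

lemma escape_le_norm_iterate {c : ℝ} (hc : c ≤ -2) (z : ℂ) (hz : fixPt c < ‖z‖) (n : ℕ) :
    fixPt c + 2 ^ n * (‖z‖ - fixPt c) ≤ ‖(fun w : ℂ => w ^ 2 + (c : ℂ))^[n] z‖ := by
  have h1 := fixPt_sq hc
  have h2 := two_le_fixPt hc
  induction n with
  | zero => simp
  | succ n ih =>
    rw [Function.iterate_succ_apply']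
    set w := (fun w : ℂ => w ^ 2 + (c : ℂ))^[n] z
    have h3 : ‖w‖ ^ 2 - (-c) ≤ ‖w ^ 2 + (c : ℂ)‖ := by
      have := norm_sub_le (w ^ 2 + (c : ℂ)) (c : ℂ)
      rw [add_sub_cancel_right, norm_pow, Complex.norm_real, Real.norm_eq_abs,
        abs_of_nonpos (by linarith)] at this
      linarith
    refine le_trans ?_ h3
    have h4 : 0 ≤ 2 ^ n * (‖z‖ - fixPt c) := mul_nonneg (by positivity) (by linarith)
    rw [pow_succ]
    nlinarith

lemma mem_filledJuliaSet_iff {c : ℝ} (hc : c ≤ -2) (z : ℂ) :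
    z ∈ filledJuliaSet c ↔ ∀ n : ℕ, ‖(fun w : ℂ => w ^ 2 + (c : ℂ))^[n] z‖ ≤ fixPt c := by
  constructor
  · intro hz n
    by_contra! hn
    rw [filledJuliaSet, Set.mem_ofPred_eq, isBounded_iff_forall_norm_le] at hz
    obtain ⟨C, hC⟩ := hz
    obtain ⟨m, hm⟩ := pow_unbounded_of_one_lt
      (C / (‖(fun w : ℂ => w ^ 2 + (c : ℂ))^[n] z‖ - fixPt c)) (one_lt_two (α := ℝ))
    have h1 := escape_le_norm_iterate hc _ hn m
    rw [← Function.iterate_add_apply] at h1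
    have h2 := hC _ ⟨m + n, rfl⟩
    rw [div_lt_iff₀ (by linarith)] at hm
    linarith [two_le_fixPt hc]
  · intro h
    rw [filledJuliaSet, Set.mem_ofPred_eq, isBounded_iff_forall_norm_le]
    refine ⟨fixPt c, ?_⟩
    rintro _ ⟨n, rfl⟩
    exact h n

lemma iterate_ofReal (c x : ℝ) (n : ℕ) :
    (fun w : ℂ => w ^ 2 + (c : ℂ))^[n] (x : ℂ) = ((quad c)^[n] x : ℝ) := by
  induction n with
  | zero => rfl
  | succ n ih => rw [Function.iterate_succ_apply', Function.iterate_succ_apply', ih]; simp [quad]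

lemma ofReal_mem_filledJuliaSet_iff {c : ℝ} (hc : c ≤ -2) (x : ℝ) :
    (x : ℂ) ∈ filledJuliaSet c ↔ x ∈ trapped c := by
  simp [mem_filledJuliaSet_iff hc, iterate_ofReal, trapped]

lemma isClosed_filledJuliaSet {c : ℝ} (hc : c ≤ -2) : IsClosed (filledJuliaSet c) := by
  have : filledJuliaSet c =
      ⋂ n : ℕ, {z | ‖(fun w : ℂ => w ^ 2 + (c : ℂ))^[n] z‖ ≤ fixPt c} := by
    ext z; simp [mem_filledJuliaSet_iff hc]
  rw [this]
  exact isClosed_iInter fun n => isClosed_le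
    ((show Continuous fun w : ℂ => w ^ 2 + (c : ℂ) by fun_prop).iterate n).norm continuous_const

/-- A trapped point is never interior to the filled Julia set, because it is a limit of preimages
of the critical point `0`, and these escape. -/
theorem realJuliaSet_eq_trapped {c : ℝ} (hc : c < -2) : realJuliaSet c = trapped c := by
  ext x
  constructor
  · intro hx
    have : (x : ℂ) ∈ closure (filledJuliaSet c) := frontier_subset_closure hx
    rw [(isClosed_filledJuliaSet hc.le).closure_eq] at this
    exact (ofReal_mem_filledJuliaSet_iff hc.le x).1 this
  · intro hx
    refine ⟨subset_closure ((ofReal_mem_filledJuliaSet_iff hc.le x).2 hx), fun hint => ?_⟩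
    have h2 := two_lt_fixPt hc
    obtain ⟨y, hy, -, hlim⟩ := exists_seq_tendsto hc.le (u := 0) (by rw [abs_zero]; linarith) hx
    have hlim' : Tendsto (fun n => (y n : ℂ)) atTop (𝓝 (x : ℂ)) :=
      (Complex.continuous_ofReal.tendsto x).comp hlim
    obtain ⟨n, hn⟩ := (hlim'.eventually (mem_interior_iff_mem_nhds.1 hint)).exists
    have h3 := (ofReal_mem_filledJuliaSet_iff hc.le _).1 hn (n + 1)
    rw [Function.iterate_succ_apply', hy] at h3
    have h4 : |quad c 0| = -c := by simp [quad, abs_of_neg (show c < 0 by linarith)]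
    rw [h4] at h3
    linarith [lt_neg_fixPt hc]

/-! ### The Ruelle operator on the two branches -/

section Ruelle

variable {E : Type*} [AddCommGroup E] [Module ℝ E]

lemma ruelle_apply {c x : ℝ} (hx : c < x) (g : ℝ → E) :
    ruelle c g x = (4 * (x - c))⁻¹ • (g (root c x) + g (-root c x)) := by
  have hr := root_pos hx
  have hd (y : ℝ) : deriv (quad c) y = 2 * y := by
    have : HasDerivAt (quad c) (2 * y) y := by
      have h := (hasDerivAt_pow 2 y).add_const c
      simp only [Nat.cast_ofNat, Nat.add_one_sub_one, pow_one] at h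
      exact h
    exact this.deriv
  have hset : quad c ⁻¹' {x} = {root c x, -root c x} := by
    ext y
    simp only [Set.mem_preimage, Set.mem_singleton_iff, Set.mem_insert_iff]
    rw [← sq_eq_sq_iff_eq_or_eq_neg, root_sq hx.le, quad]
    constructor <;> intro h <;> linarith
  have h1 : ((2 * root c x) ^ 2)⁻¹ = (4 * (x - c))⁻¹ := by
    rw [mul_pow, root_sq hx.le]; norm_num
  have h2 : ((2 * -root c x) ^ 2)⁻¹ = (4 * (x - c))⁻¹ := by rw [← h1, mul_neg, neg_sq]
  rw [ruelle, hset, finsum_mem_pair (by linarith), hd, hd, h1, h2, smul_add]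

end Ruelle

/-! ### The leading eigenvalue and the explicit eigenfunction -/

/-- The critical orbit from its second iterate on: `critOrbit c k` is `f_c^{k + 2}(0)`. -/
noncomputable def critOrbit (c : ℝ) (k : ℕ) : ℝ := (quad c)^[k + 1] c

lemma critOrbit_zero (c : ℝ) : critOrbit c 0 = c ^ 2 + c := rfl

lemma critOrbit_succ (c : ℝ) (k : ℕ) : critOrbit c (k + 1) = critOrbit c k ^ 2 + c := by
  rw [critOrbit, Function.iterate_succ_apply']; rfl

lemma neg_le_critOrbit {c : ℝ} (hc : c ≤ -2) (k : ℕ) : -c ≤ critOrbit c k := by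
  induction k with
  | zero => rw [critOrbit_zero]; nlinarith
  | succ k ih => rw [critOrbit_succ]; nlinarith

lemma critOrbit_pos {c : ℝ} (hc : c ≤ -2) (k : ℕ) : 0 < critOrbit c k := by
  linarith [neg_le_critOrbit hc k]

lemma tendsto_critOrbit {c : ℝ} (hc : c < -2) : Tendsto (critOrbit c) atTop atTop := by
  have h1 := fixPt_sq hc.le
  have h2 := two_lt_fixPt hc
  have h3 := lt_neg_fixPt hc
  have key (k : ℕ) : 2 ^ k * (-c - fixPt c) ≤ critOrbit c k := by
    have : fixPt c + 2 ^ k * (-c - fixPt c) ≤ critOrbit c k := by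
      induction k with
      | zero => have := neg_le_critOrbit hc.le 0; linarith
      | succ k ih =>
        have h4 : 0 ≤ 2 ^ k * (-c - fixPt c) := mul_nonneg (by positivity) (by linarith)
        rw [critOrbit_succ, pow_succ]
        nlinarith
    linarith
  refine tendsto_atTop_mono key ?_
  exact (tendsto_pow_atTop_atTop_of_one_lt one_lt_two).atTop_mul_const (by linarith)

/-- The coefficients `l ^ (k + 1) / ∏ (2 |f_c^j(0)|)`, the product over `1 ≤ j ≤ k + 1`, that is,
up to sign, the terms of the series `∑ l ^ n / (f_c^n)'(c)`. -/
noncomputable def coef (c l : ℝ) : ℕ → ℝ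
  | 0 => l / (-2 * c)
  | k + 1 => coef c l k * (l / (2 * critOrbit c k))

lemma coef_pos {c l : ℝ} (hc : c ≤ -2) (hl : 0 < l) (k : ℕ) : 0 < coef c l k := by
  induction k with
  | zero => exact div_pos hl (by linarith)
  | succ k ih => exact mul_pos ih (div_pos hl (by linarith [critOrbit_pos hc k]))

lemma coef_eq (c l : ℝ) (k : ℕ) : coef c l k = l ^ (k + 1) * coef c 1 k := by
  induction k with
  | zero => simp only [coef]; ring
  | succ k ih => simp only [coef]; rw [ih]; ring

lemma summable_coef {c l : ℝ} (hc : c < -2) (hl : 0 < l) : Summable (coef c l) := by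
  refine summable_of_ratio_test_tendsto_lt_one zero_lt_one
    (Eventually.of_forall fun k => (coef_pos hc.le hl k).ne') ?_
  have h : (fun k => ‖coef c l (k + 1)‖ / ‖coef c l k‖) = fun k => l / 2 / critOrbit c k := by
    ext k
    have h0 := coef_pos hc.le hl k
    rw [Real.norm_of_nonneg (coef_pos hc.le hl _).le, Real.norm_of_nonneg h0.le, coef]
    field_simp
  rw [h]
  exact tendsto_const_nhds.div_atTop (tendsto_critOrbit hc)

/-- The reciprocal of the leading eigenvalue, found as the positive zero of the (monotone) function
`l ↦ 1 - ∑ coef c l k`. -/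
lemma exists_hasSum_coef {c : ℝ} (hc : c < -2) : ∃ l, 0 < l ∧ HasSum (coef c l) 1 := by
  have hR : (0 : ℝ) < -2 * c := by linarith
  have hcont : ContinuousOn (fun l => ∑' k, coef c l k) (Set.Icc 0 (-2 * c)) := by
    refine continuousOn_tsum (u := coef c (-2 * c)) (fun k => ?_) (summable_coef hc hR) ?_
    · rw [show (fun l => coef c l k) = fun l => l ^ (k + 1) * coef c 1 k from
        funext fun l => coef_eq c l k]
      fun_prop
    · intro k l hl
      have := coef_pos hc.le one_pos k
      rw [coef_eq, coef_eq c (-2 * c), Real.norm_of_nonneg (by have := hl.1; positivity)]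
      have h0 := hl.1
      have h1 := hl.2
      gcongr
  have h0 : ∑' k, coef c 0 k = 0 := by
    rw [show coef c 0 = fun _ => 0 from funext fun k => by rw [coef_eq]; simp, tsum_zero]
  have h1 : 1 ≤ ∑' k, coef c (-2 * c) k := by
    refine le_trans ?_ ((summable_coef hc hR).le_tsum 0 fun k _ => (coef_pos hc.le hR k).le)
    rw [coef, div_self hR.ne']
  obtain ⟨l, hl, hl1⟩ := intermediate_value_Icc hR.le hcont
    (show (1 : ℝ) ∈ _ from ⟨by rw [h0]; exact zero_le_one, h1⟩)
  have hl0 : 0 < l := by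
    refine hl.1.lt_of_ne fun h => ?_
    rw [← h] at hl1
    simp only [h0] at hl1
    exact zero_ne_one hl1
  exact ⟨l, hl0, hl1 ▸ (summable_coef hc hl0).hasSum⟩

/-- The eigenfunction of the Ruelle operator with poles along the critical orbit. -/
noncomputable def eigfun (c l x : ℝ) : ℝ := 1 / (x - c) + ∑' k, coef c l k / (critOrbit c k - x)

lemma sub_le_critOrbit_sub {c x : ℝ} (hc : c ≤ -2) (hx : |x| ≤ fixPt c) (k : ℕ) :
    -c - fixPt c ≤ critOrbit c k - x := by
  linarith [neg_le_critOrbit hc k, (abs_le.1 hx).2]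

lemma critOrbit_sub_pos {c x : ℝ} (hc : c < -2) (hx : |x| ≤ fixPt c) (k : ℕ) :
    0 < critOrbit c k - x := by
  linarith [sub_le_critOrbit_sub hc.le hx k, lt_neg_fixPt hc]

lemma coef_div_le {c l x : ℝ} (hc : c < -2) (hl : 0 < l) (hx : |x| ≤ fixPt c) (k : ℕ) :
    ‖coef c l k / (critOrbit c k - x)‖ ≤ coef c l k / (-c - fixPt c) := by
  have h1 := sub_le_critOrbit_sub hc.le hx k
  have h2 := lt_neg_fixPt hc
  have h3 := coef_pos hc.le hl k
  have h4 := critOrbit_sub_pos hc hx k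
  rw [Real.norm_of_nonneg (by positivity)]
  exact div_le_div_of_nonneg_left h3.le (by linarith) h1

lemma summable_coef_div {c l x : ℝ} (hc : c < -2) (hl : 0 < l) (hx : |x| ≤ fixPt c) :
    Summable fun k => coef c l k / (critOrbit c k - x) :=
  .of_norm_bounded ((summable_coef hc hl).div_const _) (coef_div_le hc hl hx)

lemma eigfun_pos {c l x : ℝ} (hc : c < -2) (hl : 0 < l) (hx : |x| ≤ fixPt c) :
    0 < eigfun c l x :=
  add_pos_of_pos_of_nonneg (div_pos one_pos (by linarith [lt_of_abs_le hc hx]))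
    (tsum_nonneg fun k => (div_pos (coef_pos hc.le hl k) (critOrbit_sub_pos hc hx k)).le)

lemma continuousOn_eigfun {c l : ℝ} (hc : c < -2) (hl : 0 < l) :
    ContinuousOn (eigfun c l) {x | |x| ≤ fixPt c} := by
  refine ContinuousOn.add (continuousOn_const.div (by fun_prop) fun x hx => ?_) ?_
  · exact (sub_pos.2 (lt_of_abs_le hc hx)).ne'
  · refine continuousOn_tsum (fun k => ?_) ((summable_coef hc hl).div_const (-c - fixPt c))
      fun k x hx => coef_div_le hc hl hx k
    exact continuousOn_const.div (by fun_prop) fun x hx => (critOrbit_sub_pos hc hx k).ne'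

section Branches

variable {c l s : ℝ}

lemma sq_sub_sq_pos (hc : c < -2) (hs0 : 0 ≤ s) (hs : s ≤ fixPt c) : 0 < c ^ 2 - s ^ 2 := by
  have := lt_neg_fixPt hc
  nlinarith

lemma sq_le_critOrbit_sq (hc : c ≤ -2) (k : ℕ) : c ^ 2 ≤ critOrbit c k ^ 2 := by
  have := neg_le_critOrbit hc k
  nlinarith

lemma hasSum_eigfun_add (hc : c < -2) (hl : 0 < l) (hs0 : 0 ≤ s) (hs : s ≤ fixPt c) :
    HasSum (fun k => coef c l k * (2 * critOrbit c k / (critOrbit c k ^ 2 - s ^ 2)))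
      (eigfun c l s + eigfun c l (-s) - -2 * c / (c ^ 2 - s ^ 2)) := by
  have h1 : |s| ≤ fixPt c := by rwa [abs_of_nonneg hs0]
  have h2 : |-s| ≤ fixPt c := by rwa [abs_neg]
  convert (summable_coef_div hc hl h1).hasSum.add (summable_coef_div hc hl h2).hasSum using 1
  · ext k
    have h3 := critOrbit_sub_pos hc h1 k
    have h4 := critOrbit_sub_pos hc h2 k
    have h5 : critOrbit c k ^ 2 - s ^ 2 = (critOrbit c k - s) * (critOrbit c k - -s) := by ring
    rw [h5]
    field_simp
    ring
  · have h3 := lt_of_abs_le hc h1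
    have h4 := lt_of_abs_le hc h2
    have h5 : c ^ 2 - s ^ 2 = (s - c) * (-s - c) := by ring
    have h6 : s - c ≠ 0 := by linarith
    have h7 : -s - c ≠ 0 := by linarith
    have h8 : -2 * c / (c ^ 2 - s ^ 2) = 1 / (s - c) + 1 / (-s - c) := by
      rw [h5]; field_simp; ring
    rw [h8, eigfun, eigfun]
    ring

lemma hasSum_eigfun_sub (hc : c < -2) (hl : 0 < l) (hs0 : 0 ≤ s) (hs : s ≤ fixPt c) :
    HasSum (fun k => coef c l k * (2 * s / (critOrbit c k ^ 2 - s ^ 2)))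
      (2 * s / (c ^ 2 - s ^ 2) - (eigfun c l (-s) - eigfun c l s)) := by
  have h1 : |s| ≤ fixPt c := by rwa [abs_of_nonneg hs0]
  have h2 : |-s| ≤ fixPt c := by rwa [abs_neg]
  convert (summable_coef_div hc hl h1).hasSum.sub (summable_coef_div hc hl h2).hasSum using 1
  · rfl
  · ext k
    have h3 := critOrbit_sub_pos hc h1 k
    have h4 := critOrbit_sub_pos hc h2 k
    have h5 : critOrbit c k ^ 2 - s ^ 2 = (critOrbit c k - s) * (critOrbit c k - -s) := by ring
    rw [h5]
    field_simp
    ring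
  · have h3 := lt_of_abs_le hc h1
    have h4 := lt_of_abs_le hc h2
    have h5 : c ^ 2 - s ^ 2 = (s - c) * (-s - c) := by ring
    have h6 : s - c ≠ 0 := by linarith
    have h7 : -s - c ≠ 0 := by linarith
    have h8 : 2 * s / (c ^ 2 - s ^ 2) = 1 / (-s - c) - 1 / (s - c) := by
      rw [h5]; field_simp; ring
    rw [h8, eigfun, eigfun]
    ring

lemma le_eigfun_add (hc : c < -2) (hl : 0 < l) (hs0 : 0 ≤ s) (hs : s ≤ fixPt c) :
    -2 * c / (c ^ 2 - s ^ 2) ≤ eigfun c l s + eigfun c l (-s) := by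
  have h := (hasSum_eigfun_add hc hl hs0 hs).nonneg fun k => by
    have h1 := coef_pos hc.le hl k
    have h2 := critOrbit_pos hc.le k
    have h3 := sq_sub_sq_pos hc hs0 hs
    have h4 := sq_le_critOrbit_sq hc.le k
    have h5 : 0 < critOrbit c k ^ 2 - s ^ 2 := by linarith
    exact mul_nonneg h1.le (by positivity)
  linarith

lemma hasSum_asymmetry (hc : c < -2) (hl : 0 < l) (hsum : HasSum (coef c l) 1) (hs0 : 0 ≤ s)
    (hs : s ≤ fixPt c) :
    HasSum (fun k => coef c l k * (2 * s / (c ^ 2 - s ^ 2) *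
      ((critOrbit c k ^ 2 - c ^ 2) / (critOrbit c k ^ 2 - s ^ 2))))
      (eigfun c l (-s) - eigfun c l s) := by
  convert (hsum.mul_right (2 * s / (c ^ 2 - s ^ 2))).sub (hasSum_eigfun_sub hc hl hs0 hs) using 1
  · rfl
  · ext k
    have h1 := sq_sub_sq_pos hc hs0 hs
    have h2 := sq_le_critOrbit_sq hc.le k
    have h3 : critOrbit c k ^ 2 - s ^ 2 ≠ 0 := by linarith
    have h4 : c ^ 2 - s ^ 2 ≠ 0 := h1.ne'
    field_simp
    ring
  · ring

/-- The weight of the positive branch is at most the one of the negative branch. -/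
lemma eigfun_le_eigfun_neg (hc : c < -2) (hl : 0 < l) (hsum : HasSum (coef c l) 1) (hs0 : 0 ≤ s)
    (hs : s ≤ fixPt c) : eigfun c l s ≤ eigfun c l (-s) := by
  have h := (hasSum_asymmetry hc hl hsum hs0 hs).nonneg fun k => by
    have h1 := coef_pos hc.le hl k
    have h3 := sq_sub_sq_pos hc hs0 hs
    have h4 := sq_le_critOrbit_sq hc.le k
    have h5 : 0 < critOrbit c k ^ 2 - s ^ 2 := by linarith
    have h6 : 0 ≤ critOrbit c k ^ 2 - c ^ 2 := by linarith
    exact mul_nonneg h1.le (by positivity)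
  linarith

/-- A bound for the asymmetry of the two branches that tends to `0` when the critical orbit tends
to the orbit `-2 ↦ 2 ↦ 2 ↦ ⋯`. -/
noncomputable def asymBound (c l δ : ℝ) : ℝ :=
  ∑' k, coef c l k * min 1 ((critOrbit c k ^ 2 - c ^ 2) / δ)

lemma coef_mul_min_nonneg (hc : c ≤ -2) (hl : 0 < l) {δ : ℝ} (hδ : 0 < δ) (k : ℕ) :
    0 ≤ coef c l k * min 1 ((critOrbit c k ^ 2 - c ^ 2) / δ) :=
  mul_nonneg (coef_pos hc hl k).le (le_min zero_le_one
    (div_nonneg (by linarith [sq_le_critOrbit_sq hc k]) hδ.le))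

lemma coef_mul_min_le (hc : c ≤ -2) (hl : 0 < l) (δ : ℝ) (k : ℕ) :
    coef c l k * min 1 ((critOrbit c k ^ 2 - c ^ 2) / δ) ≤ coef c l k :=
  mul_le_of_le_one_right (coef_pos hc hl k).le (min_le_left _ _)

lemma asymBound_nonneg (hc : c ≤ -2) (hl : 0 < l) {δ : ℝ} (hδ : 0 < δ) : 0 ≤ asymBound c l δ :=
  tsum_nonneg (coef_mul_min_nonneg hc hl hδ)

lemma eigfun_neg_sub_le (hc : c < -2) (hl : 0 < l) (hsum : HasSum (coef c l) 1) (hs0 : 0 ≤ s)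
    (hs : s ≤ fixPt c) {δ : ℝ} (hδ : 0 < δ) (hδs : δ ≤ c ^ 2 - s ^ 2) :
    eigfun c l (-s) - eigfun c l s ≤
      (eigfun c l s + eigfun c l (-s)) * asymBound c l δ := by
  have hpos := sq_sub_sq_pos hc hs0 hs
  have hS : Summable fun k => coef c l k * min 1 ((critOrbit c k ^ 2 - c ^ 2) / δ) :=
    hsum.summable.of_nonneg_of_le (coef_mul_min_nonneg hc.le hl hδ) (coef_mul_min_le hc.le hl δ)
  have h1 : eigfun c l (-s) - eigfun c l s ≤ 2 * s / (c ^ 2 - s ^ 2) * asymBound c l δ := by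
    refine hasSum_le (fun k => ?_) (hasSum_asymmetry hc hl hsum hs0 hs)
      (hS.hasSum.mul_left (2 * s / (c ^ 2 - s ^ 2)))
    have h4 := sq_le_critOrbit_sq hc.le k
    have h5 : 0 < critOrbit c k ^ 2 - s ^ 2 := by linarith
    have h6 := coef_pos hc.le hl k
    have h7 : (critOrbit c k ^ 2 - c ^ 2) / (critOrbit c k ^ 2 - s ^ 2) ≤
        min 1 ((critOrbit c k ^ 2 - c ^ 2) / δ) := by
      refine le_min ((div_le_one h5).2 (by linarith)) ?_
      exact div_le_div_of_nonneg_left (by linarith) hδ (by linarith)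
    calc _ = 2 * s / (c ^ 2 - s ^ 2) * (coef c l k *
          ((critOrbit c k ^ 2 - c ^ 2) / (critOrbit c k ^ 2 - s ^ 2))) := by ring
      _ ≤ _ := by gcongr
  refine h1.trans (mul_le_mul_of_nonneg_right ?_ (asymBound_nonneg hc.le hl hδ))
  refine le_trans ?_ (le_eigfun_add hc hl hs0 hs)
  have := lt_neg_fixPt hc
  exact div_le_div_of_nonneg_right (by linarith) hpos.le

end Branches

/-- The partial fraction identity
`L_c (1 / (z - ·)) = (1 / (2 z)) (1 / (f_c(z) - ·) + 1 / (· - c))` turns the eigenvalue equation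
into a recursion for the coefficients, closed up by `∑ coef c l k = 1`. -/
theorem eigfun_root_add {c l x : ℝ} (hc : c < -2) (hl : 0 < l) (hsum : HasSum (coef c l) 1)
    (hx : |x| ≤ fixPt c) :
    eigfun c l (root c x) + eigfun c l (-root c x) = 4 * (x - c) / l * eigfun c l x := by
  have hcx := lt_of_abs_le hc hx
  have hs0 := root_nonneg c x
  have hs := root_le_fixPt hc.le (abs_le.1 hx).2
  have hsq := root_sq hcx.le
  have hadd := hasSum_eigfun_add hc hl hs0 hs
  have hxc : 0 < x - c := by linarith
  have hT := (summable_coef_div hc hl hx).hasSum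
  have hT' := (hasSum_nat_add_iff' 1).2 hT
  have hb' := (hasSum_nat_add_iff' 1).2 hsum
  have hmain : HasSum (fun k => coef c l k * (2 * critOrbit c k /
      (critOrbit c k ^ 2 - root c x ^ 2))) (4 * (x - c) / l *
      ((∑' k, coef c l k / (critOrbit c k - x)) - coef c l 0 / (critOrbit c 0 - x) +
        (1 - coef c l 0) * (1 / (x - c)))) := by
    convert (hT'.add (hb'.mul_right (1 / (x - c)))).mul_left (4 * (x - c) / l) using 1
    · rfl
    · ext k
      have h1 := critOrbit_sub_pos hc hx (k + 1)
      have h2 := critOrbit_pos hc.le k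
      have h3 : critOrbit c k ^ 2 - root c x ^ 2 = critOrbit c (k + 1) - x := by
        rw [hsq, critOrbit_succ]; ring
      rw [h3, show coef c l (k + 1) = coef c l k * (l / (2 * critOrbit c k)) from rfl]
      have h4 : critOrbit c k ^ 2 = critOrbit c (k + 1) - x + (x - c) := by
        rw [critOrbit_succ]; ring
      field_simp
      linear_combination 4 * coef c l k * h4
    · simp
  have h0 := hadd.unique hmain
  have h5 : c ^ 2 - root c x ^ 2 = critOrbit c 0 - x := by rw [hsq, critOrbit_zero]; ring
  have h6 := critOrbit_sub_pos hc hx 0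
  have h7 : -2 * c / (critOrbit c 0 - x) = 4 * (x - c) / l *
      (coef c l 0 / (critOrbit c 0 - x) + coef c l 0 * (1 / (x - c))) := by
    have hc0 : c ≠ 0 := by linarith
    have h8 : c ^ 2 = critOrbit c 0 - x + (x - c) := by rw [critOrbit_zero]; ring
    rw [show coef c l 0 = l / (-2 * c) from rfl]
    field_simp
    linear_combination -4 * h8
  rw [h5, h7] at h0
  rw [show eigfun c l x = 1 / (x - c) + ∑' k, coef c l k / (critOrbit c k - x) from rfl]
  linear_combination h0

lemma ruelle_eigfun {c l x : ℝ} (hc : c < -2) (hl : 0 < l) (hsum : HasSum (coef c l) 1)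
    (hx : |x| ≤ fixPt c) : ruelle c (eigfun c l) x = l⁻¹ * eigfun c l x := by
  have hcx := lt_of_abs_le hc hx
  have hxc : 0 < x - c := by linarith
  rw [ruelle_apply hcx, eigfun_root_add hc hl hsum hx, smul_eq_mul]
  field_simp

/-! ### The leading eigenvalue: maximum principle -/

/-- The variance identity: a weighted mean `w` of `a` and `b` that is at least as large as both in
modulus coincides with both. -/
lemma eq_of_weighted_mean {p q M : ℝ} {a b w : ℂ} (hp : 0 < p) (hq : 0 < q)
    (h : (p : ℂ) * a + q * b = (p + q) * w) (ha : ‖a‖ ≤ M) (hb : ‖b‖ ≤ M) (hw : M ≤ ‖w‖) :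
    a = w ∧ b = w := by
  have hM : 0 ≤ M := (norm_nonneg a).trans ha
  have h1 : ‖a‖ ^ 2 ≤ ‖w‖ ^ 2 := pow_le_pow_left₀ (norm_nonneg _) (ha.trans hw) 2
  have h2 : ‖b‖ ^ 2 ≤ ‖w‖ ^ 2 := pow_le_pow_left₀ (norm_nonneg _) (hb.trans hw) 2
  have hre := congrArg Complex.re h
  have him := congrArg Complex.im h
  simp only [Complex.add_re, Complex.add_im, Complex.mul_re, Complex.mul_im, Complex.ofReal_re,
    Complex.ofReal_im, zero_mul, sub_zero, add_zero] at hre him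
  have key : p * ‖a - w‖ ^ 2 + q * ‖b - w‖ ^ 2 =
      p * (‖a‖ ^ 2 - ‖w‖ ^ 2) + q * (‖b‖ ^ 2 - ‖w‖ ^ 2) := by
    simp only [Complex.sq_norm, Complex.normSq_apply, Complex.sub_re, Complex.sub_im]
    linear_combination -2 * w.re * hre - 2 * w.im * him
  have h3 : 0 ≤ p * ‖a - w‖ ^ 2 := by positivity
  have h4 : 0 ≤ q * ‖b - w‖ ^ 2 := by positivity
  have h5 : p * (‖a‖ ^ 2 - ‖w‖ ^ 2) ≤ 0 := mul_nonpos_of_nonneg_of_nonpos hp.le (by linarith)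
  have h6 : q * (‖b‖ ^ 2 - ‖w‖ ^ 2) ≤ 0 := mul_nonpos_of_nonneg_of_nonpos hq.le (by linarith)
  have h7 : p * ‖a - w‖ ^ 2 = 0 := by linarith
  have h8 : q * ‖b - w‖ ^ 2 = 0 := by linarith
  simp only [mul_eq_zero, hp.ne', hq.ne', false_or, ne_eq, OfNat.ofNat_ne_zero, not_false_eq_true,
    pow_eq_zero_iff, norm_eq_zero, sub_eq_zero] at h7 h8
  exact ⟨h7, h8⟩

variable {c l : ℝ}

/-- The modulus of `u` is maximal at some `x`, hence `u = ω ^ n u(x)` at the `n`-th preimages of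
`x`. These accumulate at every point, so that `ω ^ n` converges and `u` is constant. -/
lemma eq_const_of_weighted_mean (hc : c < -2) {p : ℝ → ℝ} (hp : ∀ x ∈ trapped c, 0 < p x)
    {u : ℝ → ℂ} (hu : ContinuousOn u (trapped c)) (hne : ∃ x ∈ trapped c, u x ≠ 0) {ω : ℂ}
    (hω : 1 ≤ ‖ω‖) (h : ∀ x ∈ trapped c,
      (p (root c x) : ℂ) * u (root c x) + p (-root c x) * u (-root c x) =
        (p (root c x) + p (-root c x)) * (ω * u x)) :
    ω = 1 ∧ ∃ a : ℂ, ∀ x ∈ trapped c, u x = a := by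
  obtain ⟨z, hz, hzne⟩ := hne
  obtain ⟨x₀, hx₀, hmax⟩ := (isCompact_trapped c).exists_isMaxOn ⟨z, hz⟩ hu.norm
  set M := ‖u x₀‖ with hM
  have hMz : 0 < M := (norm_pos_iff.2 hzne).trans_le (hmax hz)
  have hstep (x : ℝ) (hx : x ∈ trapped c) (hxM : ‖u x‖ = M) :
      u (root c x) = ω * u x ∧ u (-root c x) = ω * u x := by
    have h1 := root_mem_trapped hc hx
    have h2 := neg_root_mem_trapped hc hx
    refine eq_of_weighted_mean (hp _ h1) (hp _ h2) (h x hx) (hmax h1) (hmax h2) ?_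
    rw [norm_mul, hxM]
    exact le_mul_of_one_le_left hMz.le hω
  have hback (n : ℕ) : ∀ y ∈ trapped c, (quad c)^[n] y = x₀ → u y = ω ^ n * u x₀ ∧ ‖u y‖ = M := by
    induction n with
    | zero => rintro y hy rfl; simp [hM]
    | succ n ih =>
      intro y hy hyx
      rw [Function.iterate_succ_apply] at hyx
      obtain ⟨h1, h2⟩ := ih _ (quad_mem_trapped hy) hyx
      obtain ⟨h3, h4⟩ := hstep _ (quad_mem_trapped hy) h2
      have h5 : u y = ω * u (quad c y) := by
        rw [root_quad] at h3 h4
        rcases abs_choice y with h | h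
        · rwa [h] at h3
        · rwa [h, neg_neg] at h4
      have h6 : ‖u y‖ = ‖ω‖ * M := by rw [h5, norm_mul, h2]
      refine ⟨by rw [h5, h1, pow_succ]; ring, le_antisymm (hmax hy) ?_⟩
      rw [h6]
      exact le_mul_of_one_le_left hMz.le hω
  have hlim (x : ℝ) (hx : x ∈ trapped c) :
      Tendsto (fun n : ℕ => ω ^ n * u x₀) atTop (𝓝 (u x)) := by
    obtain ⟨y, hy, hyK, hyl⟩ := exists_seq_tendsto hc.le (abs_le_of_mem_trapped hx₀) hx
    have h1 : Tendsto y atTop (𝓝[trapped c] x) :=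
      tendsto_nhdsWithin_iff.2 ⟨hyl, Eventually.of_forall (hyK hx₀)⟩
    exact ((hu x hx).tendsto.comp h1).congr fun n => (hback n _ (hyK hx₀ n) (hy n)).1
  have hconst (x : ℝ) (hx : x ∈ trapped c) : u x = u x₀ :=
    tendsto_nhds_unique (hlim x hx) (hlim x₀ hx₀)
  refine ⟨?_, u x₀, hconst⟩
  have h1 := (hstep x₀ hx₀ rfl).1
  rw [hconst _ (root_mem_trapped hc hx₀)] at h1
  have h2 : u x₀ ≠ 0 := norm_pos_iff.1 hMz
  exact (mul_right_cancel₀ h2 (by rw [one_mul]; exact h1)).symm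

lemma eigfun_pos_of_mem (hc : c < -2) (hl : 0 < l) {x : ℝ} (hx : x ∈ trapped c) :
    0 < eigfun c l x :=
  eigfun_pos hc hl (abs_le_of_mem_trapped hx)

lemma continuousOn_eigfun_trapped (hc : c < -2) (hl : 0 < l) :
    ContinuousOn (eigfun c l) (trapped c) :=
  (continuousOn_eigfun hc hl).mono fun _ hx => abs_le_of_mem_trapped hx

lemma ruelle_complex_apply {x : ℝ} (hx : c < x) (g : ℝ → ℂ) :
    ruelle c g x = ((4 * (x - c))⁻¹ : ℝ) * (g (root c x) + g (-root c x)) := by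
  rw [ruelle_apply hx, Complex.real_smul]

lemma continuousOn_comp_branches {E : Type*} [TopologicalSpace E] (hc : c < -2) {g : ℝ → E}
    (hg : ContinuousOn g (trapped c)) :
    ContinuousOn (fun x => g (root c x)) (trapped c) ∧
      ContinuousOn (fun x => g (-root c x)) (trapped c) :=
  ⟨hg.comp (continuous_root c).continuousOn fun _ hx => root_mem_trapped hc hx,
    hg.comp (continuous_root c).neg.continuousOn fun _ hx => neg_root_mem_trapped hc hx⟩

lemma continuousOn_ruelle {E : Type*} [NormedAddCommGroup E] [NormedSpace ℝ E] (hc : c < -2)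
    {g : ℝ → E} (hg : ContinuousOn g (trapped c)) : ContinuousOn (ruelle c g) (trapped c) := by
  have h : ContinuousOn (fun x => (4 * (x - c))⁻¹ • (g (root c x) + g (-root c x)))
      (trapped c) := by
    refine ContinuousOn.smul (ContinuousOn.inv₀ (by fun_prop) fun x hx => ?_)
      ((continuousOn_comp_branches hc hg).1.add (continuousOn_comp_branches hc hg).2)
    have := lt_of_abs_le hc (abs_le_of_mem_trapped hx)
    linarith
  exact h.congr fun x hx => ruelle_apply (lt_of_abs_le hc (abs_le_of_mem_trapped hx)) g

/-- The eigenvalue equation in terms of the quotient by the positive eigenfunction. -/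
lemma weighted_mean_of_ruelle (hc : c < -2) (hl : 0 < l) (hsum : HasSum (coef c l) 1)
    {g : ℝ → ℂ} {x : ℝ} (hx : x ∈ trapped c) {w : ℂ} (hw : ruelle c g x = w) :
    (eigfun c l (root c x) : ℂ) * (g (root c x) / eigfun c l (root c x)) +
        eigfun c l (-root c x) * (g (-root c x) / eigfun c l (-root c x)) =
      (eigfun c l (root c x) + eigfun c l (-root c x)) * (l * w / eigfun c l x) := by
  have hx0 := abs_le_of_mem_trapped hx
  have hcx := lt_of_abs_le hc hx0
  have h1 := (eigfun_pos_of_mem hc hl (root_mem_trapped hc hx)).ne'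
  have h2 := (eigfun_pos_of_mem hc hl (neg_root_mem_trapped hc hx)).ne'
  have h3 := (eigfun_pos_of_mem hc hl hx).ne'
  have h4 : x - c ≠ 0 := by linarith
  have h5 : (x : ℂ) - c ≠ 0 := by exact_mod_cast h4
  have h6 : (l : ℂ) ≠ 0 := by exact_mod_cast hl.ne'
  have h7 : (eigfun c l x : ℂ) ≠ 0 := by exact_mod_cast h3
  rw [mul_div_cancel₀ _ (by exact_mod_cast h1), mul_div_cancel₀ _ (by exact_mod_cast h2),
    ← Complex.ofReal_add, eigfun_root_add hc hl hsum hx0, ← hw, ruelle_complex_apply hcx]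
  push_cast
  field_simp

lemma isEigenfunction_eigfun (hc : c < -2) (hl : 0 < l) (hsum : HasSum (coef c l) 1) :
    IsEigenfunction c ((l⁻¹ : ℝ) : ℂ) fun x => (eigfun c l x : ℂ) where
  continuousOn := by
    rw [realJuliaSet_eq_trapped hc]
    exact Complex.continuous_ofReal.comp_continuousOn (continuousOn_eigfun_trapped hc hl)
  ne_zero := by
    rw [realJuliaSet_eq_trapped hc]
    exact ⟨_, fixPt_mem_trapped hc.le,
      by exact_mod_cast (eigfun_pos_of_mem hc hl (fixPt_mem_trapped hc.le)).ne'⟩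
  eigen := by
    rw [realJuliaSet_eq_trapped hc]
    intro x hx
    have hx0 := abs_le_of_mem_trapped hx
    have hcx := lt_of_abs_le hc hx0
    have h := ruelle_eigfun hc hl hsum hx0
    rw [ruelle_apply hcx, smul_eq_mul] at h
    rw [ruelle_complex_apply hcx]
    exact_mod_cast h

lemma eq_of_isEigenfunction (hc : c < -2) (hl : 0 < l) (hsum : HasSum (coef c l) 1) {κ : ℂ}
    {g : ℝ → ℂ} (hg : IsEigenfunction c κ g) (hκ : l⁻¹ ≤ ‖κ‖) :
    κ = ((l⁻¹ : ℝ) : ℂ) ∧ ∃ a : ℂ, ∀ x ∈ trapped c, g x = a * eigfun c l x := by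
  obtain ⟨hcont, ⟨z, hz, hzne⟩, heig⟩ := hg
  rw [realJuliaSet_eq_trapped hc] at hcont hz heig
  have hl' : (l : ℂ) ≠ 0 := by exact_mod_cast hl.ne'
  have hne (x : ℝ) (hx : x ∈ trapped c) : (eigfun c l x : ℂ) ≠ 0 := by
    exact_mod_cast (eigfun_pos_of_mem hc hl hx).ne'
  obtain ⟨h1, a, ha⟩ := eq_const_of_weighted_mean hc (ω := l * κ)
    (fun x hx => eigfun_pos_of_mem hc hl hx)
    (hcont.div (Complex.continuous_ofReal.comp_continuousOn (continuousOn_eigfun_trapped hc hl))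
      hne) ⟨z, hz, div_ne_zero hzne (hne z hz)⟩
    (by rw [norm_mul, Complex.norm_real, Real.norm_of_nonneg hl.le]
        exact (inv_le_iff_one_le_mul₀' hl).1 hκ)
    (fun x hx => by
      refine (weighted_mean_of_ruelle hc hl hsum hx (heig x hx)).trans ?_
      simp only [Pi.div_apply, Function.comp_apply]
      ring)
  refine ⟨?_, a, fun x hx => ?_⟩
  · push_cast
    exact eq_inv_of_mul_eq_one_right h1
  · have := ha x hx
    exact (div_eq_iff (hne x hx)).1 this

theorem isLeadingEigenvalue_inv (hc : c < -2) (hl : 0 < l) (hsum : HasSum (coef c l) 1) :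
    IsLeadingEigenvalue c l⁻¹ where
  pos := inv_pos.2 hl
  isEigenvalue := ⟨_, isEigenfunction_eigfun hc hl hsum⟩
  proportional g₁ g₂ hg₁ hg₂ := by
    have hκ : l⁻¹ ≤ ‖((l⁻¹ : ℝ) : ℂ)‖ := by
      rw [Complex.norm_real, Real.norm_of_nonneg (inv_pos.2 hl).le]
    obtain ⟨-, a, ha⟩ := eq_of_isEigenfunction hc hl hsum hg₁ hκ
    obtain ⟨-, b, hb⟩ := eq_of_isEigenfunction hc hl hsum hg₂ hκ
    obtain ⟨z, hz, hzne⟩ := hg₁.ne_zero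
    rw [realJuliaSet_eq_trapped hc] at hz ⊢
    have ha0 : a ≠ 0 := fun h => hzne (by rw [ha z hz, h, zero_mul])
    exact ⟨b / a, fun x hx => by rw [ha x hx, hb x hx]; field_simp⟩
  dominant κ g hg hne := by
    by_contra! h
    exact hne (eq_of_isEigenfunction hc hl hsum hg h).1
  semisimple g hg hsq := by
    -- `(L - Λ) g = a h` by simplicity of the geometric eigenspace, and `a = 0` is seen where the
    -- real part of `conj a * g / h` is maximal.
    rw [realJuliaSet_eq_trapped hc] at hg hsq ⊢
    by_contra! hcon
    obtain ⟨z, hz, hzne⟩ := hcon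
    have hne (x : ℝ) (hx : x ∈ trapped c) : (eigfun c l x : ℂ) ≠ 0 := by
      exact_mod_cast (eigfun_pos_of_mem hc hl hx).ne'
    have hG : IsEigenfunction c ((l⁻¹ : ℝ) : ℂ)
        fun y => ruelle c g y - ((l⁻¹ : ℝ) : ℂ) * g y := by
      refine ⟨?_, ?_, ?_⟩ <;> rw [realJuliaSet_eq_trapped hc]
      · exact (continuousOn_ruelle hc hg).sub (continuousOn_const.mul hg)
      · exact ⟨z, hz, sub_ne_zero.2 hzne⟩
      · exact hsq
    obtain ⟨-, a, ha⟩ := eq_of_isEigenfunction hc hl hsum hG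
      (by rw [Complex.norm_real, Real.norm_of_nonneg (inv_pos.2 hl).le])
    have ha0 : a ≠ 0 := fun h => sub_ne_zero.2 hzne (by rw [ha z hz, h, zero_mul])
    set φ : ℝ → ℝ := fun x => ((starRingEnd ℂ) a * (g x / eigfun c l x)).re with hφ
    have hφc : ContinuousOn φ (trapped c) :=
      Complex.continuous_re.comp_continuousOn (continuousOn_const.mul (hg.div
        (Complex.continuous_ofReal.comp_continuousOn (continuousOn_eigfun_trapped hc hl)) hne))
    obtain ⟨x, hx, hmax⟩ := (isCompact_trapped c).exists_isMaxOn ⟨z, hz⟩ hφc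
    have hm := weighted_mean_of_ruelle hc hl hsum hx (w := a * eigfun c l x + (l : ℂ)⁻¹ * g x)
      (by rw [← ha x hx]; push_cast; ring)
    set p := eigfun c l (root c x)
    set q := eigfun c l (-root c x)
    have hp : 0 < p := eigfun_pos_of_mem hc hl (root_mem_trapped hc hx)
    have hq : 0 < q := eigfun_pos_of_mem hc hl (neg_root_mem_trapped hc hx)
    have hl' : (l : ℂ) ≠ 0 := by exact_mod_cast hl.ne'
    have h1 : (l : ℂ) * (a * eigfun c l x + (l : ℂ)⁻¹ * g x) / eigfun c l x =
        l * a + g x / eigfun c l x := by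
      have := hne x hx
      field_simp
    rw [h1] at hm
    have h2 : p * φ (root c x) + q * φ (-root c x) = (p + q) * (l * ‖a‖ ^ 2 + φ x) := by
      have := congrArg (fun w => ((starRingEnd ℂ) a * w).re) hm
      simp only [hφ]
      rw [Complex.sq_norm]
      have e1 : (starRingEnd ℂ) a * ((p : ℂ) * (g (root c x) / p) + q * (g (-root c x) / q)) =
          (p : ℂ) * ((starRingEnd ℂ) a * (g (root c x) / p)) +
            q * ((starRingEnd ℂ) a * (g (-root c x) / q)) := by ring
      have e2 : (starRingEnd ℂ) a * (((p : ℂ) + q) * (l * a + g x / eigfun c l x)) =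
          ((p + q : ℝ) : ℂ) * ((l * Complex.normSq a : ℝ) +
            (starRingEnd ℂ) a * (g x / eigfun c l x)) := by
        push_cast
        rw [Complex.normSq_eq_conj_mul_self]
        ring
      rw [e1, e2, Complex.add_re, Complex.re_ofReal_mul, Complex.re_ofReal_mul,
        Complex.re_ofReal_mul, Complex.add_re, Complex.ofReal_re] at this
      exact this
    have h3 : φ (root c x) ≤ φ x := hmax (root_mem_trapped hc hx)
    have h4 : φ (-root c x) ≤ φ x := hmax (neg_root_mem_trapped hc hx)
    have h5 : 0 < (p + q) * (l * ‖a‖ ^ 2) := by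
      have := norm_pos_iff.2 ha0
      positivity
    nlinarith

lemma IsLeadingEigenvalue.unique {Λ Λ' : ℝ} (h : IsLeadingEigenvalue c Λ)
    (h' : IsLeadingEigenvalue c Λ') : Λ = Λ' := by
  by_contra hne
  obtain ⟨g, hg⟩ := h.isEigenvalue
  obtain ⟨g', hg'⟩ := h'.isEigenvalue
  have h1 := h.dominant _ _ hg' (by exact_mod_cast Ne.symm hne)
  have h2 := h'.dominant _ _ hg (by exact_mod_cast hne)
  rw [Complex.norm_real, Real.norm_of_nonneg h'.pos.le] at h1
  rw [Complex.norm_real, Real.norm_of_nonneg h.pos.le] at h2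
  exact lt_asymm h1 h2

lemma isPositiveEigenfunction_eigfun (hc : c < -2) (hl : 0 < l) (hsum : HasSum (coef c l) 1) :
    IsPositiveEigenfunction c l⁻¹ (eigfun c l) := by
  refine ⟨?_, ?_, ?_⟩ <;> rw [realJuliaSet_eq_trapped hc]
  · exact continuousOn_eigfun_trapped hc hl
  · exact fun x hx => eigfun_pos_of_mem hc hl hx
  · exact fun x hx => ruelle_eigfun hc hl hsum (abs_le_of_mem_trapped hx)

lemma IsPositiveEigenfunction.exists_eq_mul_eigfun (hc : c < -2) (hl : 0 < l)
    (hsum : HasSum (coef c l) 1) {h : ℝ → ℝ} (hh : IsPositiveEigenfunction c l⁻¹ h) :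
    ∃ a : ℝ, 0 < a ∧ ∀ x ∈ trapped c, h x = a * eigfun c l x := by
  obtain ⟨hcont, hpos, heig⟩ := hh
  have hβ := fixPt_mem_trapped hc.le
  have hg : IsEigenfunction c ((l⁻¹ : ℝ) : ℂ) fun x => (h x : ℂ) := by
    rw [realJuliaSet_eq_trapped hc] at hpos heig
    refine ⟨Complex.continuous_ofReal.comp_continuousOn hcont, ?_, ?_⟩ <;>
      rw [realJuliaSet_eq_trapped hc]
    · exact ⟨_, hβ, by exact_mod_cast (hpos _ hβ).ne'⟩
    · intro x hx
      have hcx := lt_of_abs_le hc (abs_le_of_mem_trapped hx)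
      have := heig x hx
      rw [ruelle_apply hcx, smul_eq_mul] at this
      rw [ruelle_complex_apply hcx]
      exact_mod_cast this
  obtain ⟨a, ha⟩ := (isLeadingEigenvalue_inv hc hl hsum).proportional _ _
    (isEigenfunction_eigfun hc hl hsum) hg
  rw [realJuliaSet_eq_trapped hc] at ha hpos
  have hb := eigfun_pos_of_mem hc hl hβ
  have ha' : a = ((h (fixPt c) / eigfun c l (fixPt c) : ℝ) : ℂ) := by
    have h1 : (eigfun c l (fixPt c) : ℂ) ≠ 0 := by exact_mod_cast hb.ne'
    push_cast
    rw [eq_div_iff h1]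
    exact (ha _ hβ).symm
  refine ⟨_, div_pos (hpos _ hβ) hb, fun x hx => ?_⟩
  have := ha x hx
  rw [ha'] at this
  exact_mod_cast this

/-! ### Existence of the eigenmeasure -/

section Markov

variable {X : Type*} [TopologicalSpace X] {P : C(X, ℝ) →ₗ[ℝ] C(X, ℝ)}

lemma pow_nonneg_apply (hpos : ∀ f, 0 ≤ f → 0 ≤ P f) (n : ℕ) (f : C(X, ℝ)) (hf : 0 ≤ f) :
    0 ≤ (P ^ n) f := by
  induction n with
  | zero => exact hf
  | succ n ih => rw [pow_succ']; exact hpos _ ih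

lemma pow_apply_one (hone : P 1 = 1) (n : ℕ) : (P ^ n) 1 = 1 := by
  induction n with
  | zero => rfl
  | succ n ih => rw [pow_succ', Module.End.mul_apply, ih, hone]

variable [CompactSpace X]

lemma abs_pow_apply_le (hpos : ∀ f, 0 ≤ f → 0 ≤ P f) (hone : P 1 = 1) (f : C(X, ℝ)) (n : ℕ)
    (x : X) : |(P ^ n) f x| ≤ ‖f‖ := by
  have h1 : 0 ≤ ‖f‖ • (1 : C(X, ℝ)) - f := ContinuousMap.le_def.2 fun y => by
    simpa using (le_abs_self _).trans (f.norm_coe_le_norm y)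
  have h2 : 0 ≤ ‖f‖ • (1 : C(X, ℝ)) + f := ContinuousMap.le_def.2 fun y => by
    have := neg_le_of_abs_le (f.norm_coe_le_norm y)
    simpa using neg_le_iff_add_nonneg'.1 this
  have h3 := ContinuousMap.le_def.1 (pow_nonneg_apply hpos n _ h1) x
  have h4 := ContinuousMap.le_def.1 (pow_nonneg_apply hpos n _ h2) x
  rw [map_sub, map_smul, pow_apply_one hone] at h3
  rw [map_add, map_smul, pow_apply_one hone] at h4
  simp only [ContinuousMap.zero_apply, ContinuousMap.add_apply, ContinuousMap.sub_apply,
    ContinuousMap.smul_apply, ContinuousMap.one_apply, smul_eq_mul, mul_one] at h3 h4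
  exact abs_le.2 ⟨by linarith, by linarith⟩

/-- **Krylov–Bogoliubov** for Markov operators: a limit along an ultrafilter of the Cesàro means
`(1 / (n + 1)) ∑_{k ≤ n} (P ^ k f)(x₀)` is an invariant positive functional. -/
theorem exists_invariant_measure [T2Space X] [MeasurableSpace X] [BorelSpace X] [Nonempty X]
    (hpos : ∀ f, 0 ≤ f → 0 ≤ P f) (hone : P 1 = 1) :
    ∃ μ : Measure X, IsProbabilityMeasure μ ∧ ∀ f : C(X, ℝ), ∫ x, P f x ∂μ = ∫ x, f x ∂μ := by
  obtain ⟨x₀⟩ := ‹Nonempty X›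
  let A (n : ℕ) (f : C(X, ℝ)) : ℝ := ((n : ℝ) + 1)⁻¹ * ∑ k ∈ Finset.range (n + 1), (P ^ k) f x₀
  have hA (n : ℕ) (f : C(X, ℝ)) : A n f ∈ Set.Icc (-‖f‖) ‖f‖ := by
    rw [Set.mem_Icc, ← abs_le, abs_mul, abs_of_nonneg (by positivity),
      inv_mul_le_iff₀ (by positivity)]
    refine (Finset.abs_sum_le_sum_abs _ _).trans ?_
    refine (Finset.sum_le_sum fun k _ => abs_pow_apply_le hpos hone f k x₀).trans ?_
    simp
  have hL (f : C(X, ℝ)) : ∃ y, Tendsto (fun n => A n f) (hyperfilter ℕ) (𝓝 y) := by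
    obtain ⟨y, -, hy⟩ := isCompact_Icc.ultrafilter_le_nhds'
      ((hyperfilter ℕ).map fun n => A n f) (Ultrafilter.mem_map.2 (univ_mem' fun n => hA n f))
    exact ⟨y, hy⟩
  choose Λ hΛ using hL
  have hadd (f g : C(X, ℝ)) : Λ (f + g) = Λ f + Λ g := by
    refine tendsto_nhds_unique (hΛ _) (((hΛ f).add (hΛ g)).congr fun n => ?_)
    simp only [A, map_add, ContinuousMap.add_apply, Finset.sum_add_distrib, mul_add]
  have hsmul (a : ℝ) (f : C(X, ℝ)) : Λ (a • f) = a • Λ f := by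
    refine tendsto_nhds_unique (hΛ _) (((hΛ f).const_smul a).congr fun n => ?_)
    simp only [A, map_smul, ContinuousMap.smul_apply, smul_eq_mul, ← Finset.mul_sum]
    ring
  have hmono (f g : C(X, ℝ)) (hfg : f ≤ g) : Λ f ≤ Λ g := by
    refine le_of_tendsto_of_tendsto' (hΛ f) (hΛ g) fun n => ?_
    refine mul_le_mul_of_nonneg_left (Finset.sum_le_sum fun k _ => ?_) (by positivity)
    have := ContinuousMap.le_def.1 (pow_nonneg_apply hpos k _ (sub_nonneg.2 hfg)) x₀
    rw [map_sub] at this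
    simpa using this
  have hΛ1 : Λ 1 = 1 := by
    refine tendsto_nhds_unique (hΛ 1) (tendsto_const_nhds.congr fun n => ?_)
    have h2 : (n : ℝ) + 1 ≠ 0 := by positivity
    simp [A, pow_apply_one hone, h2]
  have hinv (f : C(X, ℝ)) : Λ (P f) = Λ f := by
    have h1 : Tendsto (fun n : ℕ => ((n : ℝ) + 1)⁻¹ * (2 * ‖f‖)) (hyperfilter ℕ) (𝓝 0) := by
      have := (tendsto_one_div_add_atTop_nhds_zero_nat (𝕜 := ℝ)).mul_const (2 * ‖f‖)
      simp only [one_div, zero_mul] at this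
      exact this.mono_left Nat.hyperfilter_le_atTop
    have h2 : Tendsto (fun n => A n (P f) - A n f) (hyperfilter ℕ) (𝓝 0) := by
      refine squeeze_zero_norm (fun n => ?_) h1
      have h3 : A n (P f) - A n f = ((n : ℝ) + 1)⁻¹ * ((P ^ (n + 1)) f x₀ - f x₀) := by
        simp only [A]
        rw [← mul_sub, ← Finset.sum_sub_distrib]
        congr 1
        have h4 (k : ℕ) : (P ^ k) (P f) x₀ - (P ^ k) f x₀ =
            (P ^ (k + 1)) f x₀ - (P ^ k) f x₀ := by rw [pow_succ]; rfl
        simp_rw [h4]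
        rw [Finset.sum_range_sub (fun k => (P ^ k) f x₀)]
        simp
      rw [h3, Real.norm_eq_abs, abs_mul, abs_of_nonneg (by positivity)]
      refine mul_le_mul_of_nonneg_left ?_ (by positivity)
      refine (abs_sub _ _).trans ?_
      linarith [abs_pow_apply_le hpos hone f (n + 1) x₀, f.norm_coe_le_norm x₀,
        Real.norm_eq_abs (f x₀)]
    exact sub_eq_zero.1 (tendsto_nhds_unique ((hΛ (P f)).sub (hΛ f)) h2)
  let Λ' : CompactlySupportedContinuousMap X ℝ →ₚ[ℝ] ℝ :=
    { toFun := fun g => Λ g.toContinuousMap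
      map_add' := fun g g' => hadd _ _
      map_smul' := fun a g => hsmul _ _
      monotone' := fun g g' h => hmono _ _ h }
  have hint (f : C(X, ℝ)) : ∫ x, f x ∂(RealRMK.rieszMeasure Λ') = Λ f :=
    RealRMK.integral_rieszMeasure Λ' ⟨f, HasCompactSupport.of_compactSpace f⟩
  refine ⟨RealRMK.rieszMeasure Λ', ⟨?_⟩, fun f => by rw [hint, hint, hinv]⟩
  have h1 := hint 1
  simp only [ContinuousMap.one_apply, integral_const, smul_eq_mul, mul_one, hΛ1] at h1
  exact (ENNReal.toReal_eq_one_iff _).1 h1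

end Markov

/-- The Ruelle operator normalized by its positive eigenfunction, as a Markov operator on the
continuous functions on the Julia set. -/
noncomputable def markov (hc : c < -2) (hl : 0 < l) :
    C(trapped c, ℝ) →ₗ[ℝ] C(trapped c, ℝ) where
  toFun f :=
    { toFun := fun x =>
        (eigfun c l (root c x) * f ⟨root c x, root_mem_trapped hc x.2⟩ +
          eigfun c l (-root c x) * f ⟨-root c x, neg_root_mem_trapped hc x.2⟩) /
        (eigfun c l (root c x) + eigfun c l (-root c x))
      continuous_toFun := by
        have h1 : Continuous fun x : trapped c => root c x :=
          (continuous_root c).comp continuous_subtype_val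
        have h2 := continuousOn_iff_continuous_domRestrict.1
          (continuousOn_comp_branches hc (continuousOn_eigfun_trapped hc hl)).1
        have h3 := continuousOn_iff_continuous_domRestrict.1
          (continuousOn_comp_branches hc (continuousOn_eigfun_trapped hc hl)).2
        refine Continuous.div ((h2.mul (f.continuous.comp (h1.subtype_mk _))).add
          (h3.mul (f.continuous.comp (h1.neg.subtype_mk _)))) (h2.add h3) fun x => ?_
        exact (add_pos (eigfun_pos_of_mem hc hl (root_mem_trapped hc x.2))
          (eigfun_pos_of_mem hc hl (neg_root_mem_trapped hc x.2))).ne' }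
  map_add' f g := by ext x; simp only [ContinuousMap.coe_mk, ContinuousMap.add_apply]; ring
  map_smul' a f := by
    ext x
    simp only [ContinuousMap.coe_mk, ContinuousMap.smul_apply, smul_eq_mul, RingHom.id_apply]
    ring

lemma markov_apply (hc : c < -2) (hl : 0 < l) (f : C(trapped c, ℝ)) (x : trapped c) :
    markov hc hl f x = (eigfun c l (root c x) * f ⟨root c x, root_mem_trapped hc x.2⟩ +
          eigfun c l (-root c x) * f ⟨-root c x, neg_root_mem_trapped hc x.2⟩) /
        (eigfun c l (root c x) + eigfun c l (-root c x)) := rfl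

lemma markov_nonneg (hc : c < -2) (hl : 0 < l) (f : C(trapped c, ℝ)) (hf : 0 ≤ f) :
    0 ≤ markov hc hl f := ContinuousMap.le_def.2 fun x => by
  have h1 := eigfun_pos_of_mem hc hl (root_mem_trapped hc x.2)
  have h2 := eigfun_pos_of_mem hc hl (neg_root_mem_trapped hc x.2)
  have h3 := ContinuousMap.le_def.1 hf
  rw [markov_apply]
  exact div_nonneg (add_nonneg (mul_nonneg h1.le (h3 _)) (mul_nonneg h2.le (h3 _)))
    (add_pos h1 h2).le

lemma markov_one (hc : c < -2) (hl : 0 < l) : markov hc hl 1 = 1 := by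
  ext x
  have h1 := eigfun_pos_of_mem hc hl (root_mem_trapped hc x.2)
  have h2 := eigfun_pos_of_mem hc hl (neg_root_mem_trapped hc x.2)
  rw [markov_apply, ContinuousMap.one_apply, ContinuousMap.one_apply, ContinuousMap.one_apply,
    mul_one, mul_one, div_self (add_pos h1 h2).ne']

lemma continuous_eigfun_coe (hc : c < -2) (hl : 0 < l) :
    Continuous fun x : trapped c => eigfun c l x :=
  continuousOn_iff_continuous_domRestrict.1 (continuousOn_eigfun_trapped hc hl)

lemma eigfun_coe_pos (hc : c < -2) (hl : 0 < l) (x : trapped c) : 0 < eigfun c l x :=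
  eigfun_pos_of_mem hc hl x.2

lemma continuous_inv_eigfun_coe (hc : c < -2) (hl : 0 < l) :
    Continuous fun x : trapped c => (eigfun c l x)⁻¹ :=
  (continuous_eigfun_coe hc hl).inv₀ fun x => (eigfun_coe_pos hc hl x).ne'

lemma measurableEmbedding_coe_trapped (c : ℝ) :
    MeasurableEmbedding ((↑) : trapped c → ℝ) :=
  .subtype_coe (isClosed_trapped c).measurableSet

/-- The measure `(1 / h) μ`, for a measure `μ` on the Julia set. -/
noncomputable def divEigfun (c l : ℝ) (μ : Measure (trapped c)) : Measure ℝ :=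
  (μ.withDensity fun x => ENNReal.ofReal (eigfun c l x)⁻¹).map (↑)

variable {μ : Measure (trapped c)}

lemma integral_divEigfun (hc : c < -2) (hl : 0 < l) (g : ℝ → ℝ) :
    ∫ x, g x ∂(divEigfun c l μ) = ∫ x : trapped c, (eigfun c l x)⁻¹ * g x ∂μ := by
  rw [divEigfun, (measurableEmbedding_coe_trapped c).integral_map,
    integral_withDensity_eq_integral_toReal_smul
      (continuous_inv_eigfun_coe hc hl).measurable.ennreal_ofReal
      (Eventually.of_forall fun x => ENNReal.ofReal_lt_top)]
  refine integral_congr_ae (Eventually.of_forall fun x => ?_)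
  simp only [smul_eq_mul]
  rw [ENNReal.toReal_ofReal (inv_pos.2 (eigfun_coe_pos hc hl x)).le]

lemma isFiniteMeasure_divEigfun [IsFiniteMeasure μ] (hc : c < -2) (hl : 0 < l) :
    IsFiniteMeasure (divEigfun c l μ) := by
  have : CompactSpace (trapped c) := isCompact_iff_compactSpace.1 (isCompact_trapped c)
  have := isFiniteMeasure_withDensity_ofReal (μ := μ)
    ((continuous_inv_eigfun_coe hc hl).integrable_of_hasCompactSupport
      (HasCompactSupport.of_compactSpace _)).2
  unfold divEigfun
  infer_instance

lemma divEigfun_withDensity_univ [IsProbabilityMeasure μ] (hc : c < -2) (hl : 0 < l) :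
    ((divEigfun c l μ).withDensity fun x => ENNReal.ofReal (eigfun c l x)) Set.univ = 1 := by
  rw [withDensity_apply _ MeasurableSet.univ, Measure.restrict_univ, divEigfun,
    (measurableEmbedding_coe_trapped c).lintegral_map,
    lintegral_withDensity_eq_lintegral_mul _
      (continuous_inv_eigfun_coe hc hl).measurable.ennreal_ofReal
      (continuous_eigfun_coe hc hl).measurable.ennreal_ofReal]
  refine (lintegral_congr fun x => ?_).trans (lintegral_one.trans measure_univ)
  have hx := eigfun_coe_pos hc hl x
  rw [Pi.mul_apply, ← ENNReal.ofReal_mul (inv_pos.2 hx).le, inv_mul_cancel₀ hx.ne',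
    ENNReal.ofReal_one]

lemma inv_eigfun_mul_ruelle (hc : c < -2) (hl : 0 < l) (hsum : HasSum (coef c l) 1) {g : ℝ → ℝ}
    (hg : Continuous fun x : trapped c => g x) (x : trapped c) :
    (eigfun c l x)⁻¹ * ruelle c g x = l⁻¹ * markov hc hl
      ⟨fun x : trapped c => (eigfun c l x)⁻¹ * g x, (continuous_inv_eigfun_coe hc hl).mul hg⟩ x := by
  have h0 := abs_le_of_mem_trapped x.2
  have hcx := lt_of_abs_le hc h0
  have h1 := (eigfun_pos_of_mem hc hl (root_mem_trapped hc x.2)).ne'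
  have h2 := (eigfun_pos_of_mem hc hl (neg_root_mem_trapped hc x.2)).ne'
  have h3 := (eigfun_coe_pos hc hl x).ne'
  have h4 : (x : ℝ) - c ≠ 0 := by linarith
  rw [markov_apply]
  simp only [ContinuousMap.coe_mk]
  rw [ruelle_apply hcx, mul_inv_cancel_left₀ h1, mul_inv_cancel_left₀ h2,
    eigfun_root_add hc hl hsum h0, smul_eq_mul]
  field_simp

theorem exists_isEigenmeasure (hc : c < -2) (hl : 0 < l) (hsum : HasSum (coef c l) 1) :
    ∃ ν : Measure ℝ, IsEigenmeasure c l⁻¹ ν ∧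
      IsProbabilityMeasure (ν.withDensity fun x => ENNReal.ofReal (eigfun c l x)) := by
  have : CompactSpace (trapped c) := isCompact_iff_compactSpace.1 (isCompact_trapped c)
  have : Nonempty (trapped c) := ⟨_, fixPt_mem_trapped hc.le⟩
  obtain ⟨μ, hμ, hinv⟩ := exists_invariant_measure (markov_nonneg hc hl) (markov_one hc hl)
  have hdens := divEigfun_withDensity_univ (μ := μ) hc hl
  refine ⟨divEigfun c l μ, ⟨isFiniteMeasure_divEigfun hc hl, fun h0 => ?_, ?_, fun g hg => ?_⟩,
    ⟨hdens⟩⟩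
  · rw [h0] at hdens
    simp at hdens
  · rw [realJuliaSet_eq_trapped hc, divEigfun, (measurableEmbedding_coe_trapped c).map_apply,
      show ((↑) : trapped c → ℝ) ⁻¹' (trapped c)ᶜ = ∅ by ext x; simp, measure_empty]
  · rw [realJuliaSet_eq_trapped hc] at hg
    have hgc : Continuous fun x : trapped c => g x := continuousOn_iff_continuous_domRestrict.1 hg
    rw [integral_divEigfun hc hl, integral_divEigfun hc hl]
    simp_rw [inv_eigfun_mul_ruelle hc hl hsum hgc]
    rw [integral_const_mul, hinv]
    rfl

/-! ### Uniqueness of the eigenmeasure -/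

lemma IsEigenmeasure.ae_mem {Λ : ℝ} {ν : Measure ℝ} (hc : c < -2) (hν : IsEigenmeasure c Λ ν) :
    ∀ᵐ x ∂ν, x ∈ trapped c := by
  have := hν.supported
  rwa [realJuliaSet_eq_trapped hc] at this

lemma integrable_of_continuousOn {ν : Measure ℝ} [IsFiniteMeasure ν]
    (hν : ∀ᵐ x ∂ν, x ∈ trapped c) {g : ℝ → ℝ} (hg : ContinuousOn g (trapped c)) :
    Integrable g ν := by
  have := hg.integrableOn_compact (μ := ν) (isCompact_trapped c)
  rwa [IntegrableOn, Measure.restrict_eq_self_of_ae_mem hν] at this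

lemma IsEigenmeasure.integral_odd {Λ : ℝ} {ν : Measure ℝ} (hc : c < -2) (hΛ : 0 < Λ)
    (hν : IsEigenmeasure c Λ ν) (k : ℕ) : ∫ x, x ^ (2 * k + 1) ∂ν = 0 := by
  have h1 := hν.eigen (fun x => x ^ (2 * k + 1)) (by fun_prop)
  have h2 : ∫ x, ruelle c (fun x => x ^ (2 * k + 1)) x ∂ν = 0 := by
    rw [← integral_zero ℝ ℝ (μ := ν)]
    refine integral_congr_ae ?_
    filter_upwards [hν.ae_mem hc] with x hx
    rw [ruelle_apply (lt_of_abs_le hc (abs_le_of_mem_trapped hx)), Odd.neg_pow ⟨k, rfl⟩]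
    simp
  rw [h2] at h1
  exact (mul_eq_zero.1 h1.symm).resolve_left hΛ.ne'

lemma IsEigenmeasure.integral_even {Λ : ℝ} {ν : Measure ℝ} (hc : c < -2)
    (hν : IsEigenmeasure c Λ ν) (k : ℕ) :
    Λ * ∫ x, x ^ (2 * (k + 1)) ∂ν = ∫ x, (x - c) ^ k / 2 ∂ν := by
  rw [← hν.eigen (fun x => x ^ (2 * (k + 1))) (by fun_prop)]
  refine integral_congr_ae ?_
  filter_upwards [hν.ae_mem hc] with x hx
  have hcx := lt_of_abs_le hc (abs_le_of_mem_trapped hx)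
  have h4 : (x : ℝ) - c ≠ 0 := by linarith
  rw [ruelle_apply hcx, pow_mul, pow_mul, neg_sq, root_sq hcx.le, pow_succ, smul_eq_mul]
  field_simp
  ring

/-- All moments of an eigenmeasure are determined by its mass: the weight is even, which kills the
odd moments, and `L_c (x ^ (2 k + 2)) = (x - c) ^ k / 2`. -/
lemma IsEigenmeasure.integral_polynomial {Λ : ℝ} {ν ν' : Measure ℝ} (hc : c < -2) (hΛ : 0 < Λ)
    (hν : IsEigenmeasure c Λ ν) (hν' : IsEigenmeasure c Λ ν') (p : Polynomial ℝ) :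
    ν'.real Set.univ * ∫ x, p.eval x ∂ν = ν.real Set.univ * ∫ x, p.eval x ∂ν' := by
  have := hν.finite
  have := hν'.finite
  have hi (q : Polynomial ℝ) : Integrable (fun x => q.eval x) ν :=
    integrable_of_continuousOn (hν.ae_mem hc) q.continuous.continuousOn
  have hi' (q : Polynomial ℝ) : Integrable (fun x => q.eval x) ν' :=
    integrable_of_continuousOn (hν'.ae_mem hc) q.continuous.continuousOn
  have hlin (n : ℕ) (hn : ∀ k < n, ν'.real Set.univ * ∫ x, x ^ k ∂ν =
      ν.real Set.univ * ∫ x, x ^ k ∂ν') (q : Polynomial ℝ) (hq : q.natDegree < n) :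
      ν'.real Set.univ * ∫ x, q.eval x ∂ν = ν.real Set.univ * ∫ x, q.eval x ∂ν' := by
    have hx (k : ℕ) : Integrable (fun x : ℝ => q.coeff k * x ^ k) ν :=
      (by simpa using hi (Polynomial.X ^ k) : Integrable (fun x : ℝ => x ^ k) ν).const_mul _
    have hx' (k : ℕ) : Integrable (fun x : ℝ => q.coeff k * x ^ k) ν' :=
      (by simpa using hi' (Polynomial.X ^ k) : Integrable (fun x : ℝ => x ^ k) ν').const_mul _
    simp_rw [Polynomial.eval_eq_sum_range' hq]
    rw [integral_finsetSum _ fun k _ => hx k, integral_finsetSum _ fun k _ => hx' k,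
      Finset.mul_sum, Finset.mul_sum]
    refine Finset.sum_congr rfl fun k hk => ?_
    rw [integral_const_mul, integral_const_mul, mul_left_comm, hn k (Finset.mem_range.1 hk),
      mul_left_comm]
  have hmom (n : ℕ) : ν'.real Set.univ * ∫ x, x ^ n ∂ν = ν.real Set.univ * ∫ x, x ^ n ∂ν' := by
    induction n using Nat.strong_induction_on with
    | _ n ih =>
      obtain ⟨k, rfl | rfl⟩ := Nat.even_or_odd' n
      · cases k with
        | zero => simp [mul_comm]
        | succ k =>
          have h1 := hν.integral_even hc k
          have h2 := hν'.integral_even hc k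
          have h3 := hlin (2 * (k + 1)) ih ((Polynomial.X - Polynomial.C c) ^ k * Polynomial.C 2⁻¹)
            (by
              refine (Polynomial.natDegree_mul_C_le _ _).trans_lt ?_
              rw [Polynomial.natDegree_pow, Polynomial.natDegree_X_sub_C]
              omega)
          simp only [Polynomial.eval_mul, Polynomial.eval_pow, Polynomial.eval_sub,
            Polynomial.eval_X, Polynomial.eval_C, ← div_eq_mul_inv] at h3
          rw [← h1, ← h2] at h3
          refine mul_left_cancel₀ hΛ.ne' ?_
          linarith
      · rw [hν.integral_odd hc hΛ, hν'.integral_odd hc hΛ, mul_zero, mul_zero]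
  exact hlin _ (fun k _ => hmom k) p (Nat.lt_succ_self _)

lemma IsEigenmeasure.integral_eq {Λ : ℝ} {ν ν' : Measure ℝ} (hc : c < -2) (hΛ : 0 < Λ)
    (hν : IsEigenmeasure c Λ ν) (hν' : IsEigenmeasure c Λ ν') {f : ℝ → ℝ} (hf : Continuous f) :
    ν'.real Set.univ * ∫ x, f x ∂ν = ν.real Set.univ * ∫ x, f x ∂ν' := by
  have := hν.finite
  have := hν'.finite
  set m := ν.real Set.univ with hm
  set m' := ν'.real Set.univ with hm'
  have hm0 : 0 ≤ m := measureReal_nonneg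
  have hm0' : 0 ≤ m' := measureReal_nonneg
  refine eq_of_abs_sub_le_all fun ε hε => ?_
  obtain ⟨p, hp⟩ := exists_polynomial_near_of_continuousOn (-fixPt c) (fixPt c) f hf.continuousOn
    (ε / (2 * m * m' + 1)) (by positivity)
  have hclose (μ : Measure ℝ) [IsFiniteMeasure μ] (hμ : ∀ᵐ x ∂μ, x ∈ trapped c) :
      |∫ x, p.eval x ∂μ - ∫ x, f x ∂μ| ≤ ε / (2 * m * m' + 1) * μ.real Set.univ := by
    rw [← integral_sub (integrable_of_continuousOn hμ p.continuous.continuousOn)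
      (integrable_of_continuousOn hμ hf.continuousOn)]
    rw [← Real.norm_eq_abs]
    refine norm_integral_le_of_norm_le_const ?_
    filter_upwards [hμ] with x hx using (hp x (trapped_subset_Icc c hx)).le
  have h1 := hclose ν (hν.ae_mem hc)
  have h2 := hclose ν' (hν'.ae_mem hc)
  have h3 := hν.integral_polynomial hc hΛ hν' p
  rw [← hm, ← hm'] at h3
  have h4 : m' * ∫ x, f x ∂ν - m * ∫ x, f x ∂ν' =
      m * (∫ x, p.eval x ∂ν' - ∫ x, f x ∂ν') - m' * (∫ x, p.eval x ∂ν - ∫ x, f x ∂ν) := by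
    linarith
  rw [h4]
  refine (abs_sub _ _).trans ?_
  rw [abs_mul, abs_mul, abs_of_nonneg hm0, abs_of_nonneg hm0']
  calc _ ≤ m * (ε / (2 * m * m' + 1) * m') + m' * (ε / (2 * m * m' + 1) * m) := by gcongr
    _ = ε * (2 * m * m' / (2 * m * m' + 1)) := by ring
    _ ≤ ε * 1 := by
      gcongr
      rw [div_le_one (by positivity)]
      linarith
    _ = ε := mul_one ε

lemma IsEigenmeasure.smul_eq {Λ : ℝ} {ν ν' : Measure ℝ} (hc : c < -2) (hΛ : 0 < Λ)
    (hν : IsEigenmeasure c Λ ν) (hν' : IsEigenmeasure c Λ ν') :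
    (ν' Set.univ).toNNReal • ν = (ν Set.univ).toNNReal • ν' := by
  have := hν.finite
  have := hν'.finite
  refine ext_of_forall_integral_eq_of_IsFiniteMeasure fun f => ?_
  rw [integral_smul_nnreal_measure, integral_smul_nnreal_measure]
  exact hν.integral_eq hc hΛ hν' f.continuous

lemma IsEigenmeasure.smul {Λ : ℝ} {ν : Measure ℝ} (hν : IsEigenmeasure c Λ ν) {a : NNReal}
    (ha : a ≠ 0) : IsEigenmeasure c Λ (a • ν) where
  finite := by have := hν.finite; infer_instance
  ne_zero h := hν.ne_zero ((smul_eq_zero.1 h).resolve_left ha)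
  supported := by simp [hν.supported]
  eigen g hg := by
    rw [integral_smul_nnreal_measure, integral_smul_nnreal_measure, hν.eigen g hg, mul_smul_comm]

/-! ### Existence and uniqueness of the Gibbs state -/

/-- Every Gibbs state has the explicit eigenfunction as its density. -/
lemma IsGibbsState.exists_eigenmeasure (hc : c < -2) (hl : 0 < l) (hsum : HasSum (coef c l) 1)
    {σ : ProbabilityMeasure ℝ} (hσ : IsGibbsState c σ) : ∃ ν : Measure ℝ, IsEigenmeasure c l⁻¹ ν ∧
      (σ : Measure ℝ) = ν.withDensity fun x => ENNReal.ofReal (eigfun c l x) := by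
  obtain ⟨Λ, h, ν, hΛ, hh, hν, hσν⟩ := hσ
  obtain rfl := hΛ.unique (isLeadingEigenvalue_inv hc hl hsum)
  obtain ⟨a, ha, hah⟩ := hh.exists_eq_mul_eigfun hc hl hsum
  refine ⟨a.toNNReal • ν, hν.smul (by simpa using ha), ?_⟩
  rw [hσν, ENNReal.smul_def, withDensity_smul_measure, ← withDensity_smul' _ _ ENNReal.coe_ne_top]
  refine withDensity_congr_ae ?_
  filter_upwards [hν.ae_mem hc] with x hx
  rw [hah x hx, ENNReal.ofReal_mul ha.le]
  rfl

theorem existsUnique_isGibbsState (hc : c < -2) : ∃! σ : ProbabilityMeasure ℝ,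
    IsGibbsState c σ := by
  obtain ⟨l, hl, hsum⟩ := exists_hasSum_coef hc
  obtain ⟨ν, hν, hprob⟩ := exists_isEigenmeasure hc hl hsum
  refine ⟨⟨_, hprob⟩, ⟨l⁻¹, eigfun c l, ν, isLeadingEigenvalue_inv hc hl hsum,
    isPositiveEigenfunction_eigfun hc hl hsum, hν, rfl⟩, fun σ hσ => ?_⟩
  obtain ⟨ν', hν', hσ'⟩ := hσ.exists_eigenmeasure hc hl hsum
  have := hν.finite
  have := hν'.finite
  have h1 := congrArg (fun μ => Measure.withDensity μ fun x => ENNReal.ofReal (eigfun c l x))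
    (hν.smul_eq hc (inv_pos.2 hl) hν')
  simp only [ENNReal.smul_def, withDensity_smul_measure] at h1
  rw [← hσ'] at h1
  have h2 := congrArg (fun μ => μ Set.univ) h1
  simp only [Measure.smul_apply, measure_univ, smul_eq_mul, mul_one] at h2
  rw [← h2] at h1
  have h3 : ((ν' Set.univ).toNNReal : ENNReal) ≠ 0 := by
    rw [ENNReal.coe_toNNReal (measure_ne_top _ _)]
    simpa using hν'.ne_zero
  ext s -
  have h4 := congrArg (fun μ => μ s) h1
  simp only [Measure.smul_apply, smul_eq_mul] at h4
  exact ((ENNReal.mul_right_inj h3 ENNReal.coe_ne_top).1 h4).symm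

/-! ### Invariance of Gibbs states and the asymmetry of the branches -/

/-- The normalized Ruelle operator on functions on the line: the mean over the two preimages with
the weights given by the eigenfunction. -/
noncomputable def weightedMean (c l : ℝ) (g : ℝ → ℝ) (x : ℝ) : ℝ :=
  (eigfun c l (root c x) * g (root c x) + eigfun c l (-root c x) * g (-root c x)) /
    (eigfun c l (root c x) + eigfun c l (-root c x))

/-- The unweighted mean over the two preimages. -/
noncomputable def halfMean (c : ℝ) (g : ℝ → ℝ) (x : ℝ) : ℝ := (g (root c x) + g (-root c x)) / 2

/-- The difference of the weights of the negative and the positive branch. -/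
noncomputable def asymmetry (c l x : ℝ) : ℝ :=
  (eigfun c l (-root c x) - eigfun c l (root c x)) /
    (eigfun c l (root c x) + eigfun c l (-root c x))

/-- `σ` is a probability measure `h ν` with `h` the explicit eigenfunction and `ν` an
eigenmeasure. -/
structure IsExplicitGibbs (c l : ℝ) (σ : Measure ℝ) : Prop where
  lt : c < -2
  pos : 0 < l
  hasSum : HasSum (coef c l) 1
  prob : IsProbabilityMeasure σ
  exists_eq : ∃ ν : Measure ℝ, IsEigenmeasure c l⁻¹ ν ∧
    σ = ν.withDensity fun x => ENNReal.ofReal (eigfun c l x)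

variable {σ : Measure ℝ}

lemma continuousOn_weightedMean (hc : c < -2) (hl : 0 < l) {g : ℝ → ℝ}
    (hg : ContinuousOn g (trapped c)) : ContinuousOn (weightedMean c l g) (trapped c) := by
  have h1 := continuousOn_comp_branches hc (continuousOn_eigfun_trapped hc hl)
  have h2 := continuousOn_comp_branches hc hg
  refine ((h1.1.mul h2.1).add (h1.2.mul h2.2)).div (h1.1.add h1.2) fun x hx => ?_
  exact (add_pos (eigfun_pos_of_mem hc hl (root_mem_trapped hc hx))
    (eigfun_pos_of_mem hc hl (neg_root_mem_trapped hc hx))).ne'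

lemma continuousOn_asymmetry (hc : c < -2) (hl : 0 < l) :
    ContinuousOn (asymmetry c l) (trapped c) := by
  have h1 := continuousOn_comp_branches hc (continuousOn_eigfun_trapped hc hl)
  refine (h1.2.sub h1.1).div (h1.1.add h1.2) fun x hx => ?_
  exact (add_pos (eigfun_pos_of_mem hc hl (root_mem_trapped hc hx))
    (eigfun_pos_of_mem hc hl (neg_root_mem_trapped hc hx))).ne'

lemma continuous_halfMean (c : ℝ) {g : ℝ → ℝ} (hg : Continuous g) : Continuous (halfMean c g) := by
  have := continuous_root c
  unfold halfMean
  fun_prop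

namespace IsExplicitGibbs

lemma ae_mem (h : IsExplicitGibbs c l σ) : ∀ᵐ x ∂σ, x ∈ trapped c := by
  obtain ⟨ν, hν, rfl⟩ := h.exists_eq
  exact (withDensity_absolutelyContinuous _ _).ae_le (hν.ae_mem h.lt)

lemma integrable (h : IsExplicitGibbs c l σ) {g : ℝ → ℝ} (hg : ContinuousOn g (trapped c)) :
    Integrable g σ :=
  have := h.prob
  integrable_of_continuousOn h.ae_mem hg

lemma integral_weightedMean (h : IsExplicitGibbs c l σ) {g : ℝ → ℝ}
    (hg : ContinuousOn g (trapped c)) : ∫ x, weightedMean c l g x ∂σ = ∫ x, g x ∂σ := by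
  obtain ⟨hc, hl, hsum, -, ν, hν, rfl⟩ := h
  have := hν.finite
  have hcont := continuousOn_eigfun_trapped hc hl
  have hdens (g : ℝ → ℝ) : ∫ x, g x ∂(ν.withDensity fun x => ENNReal.ofReal (eigfun c l x)) =
      ∫ x, eigfun c l x * g x ∂ν := by
    rw [integral_withDensity_eq_integral_toReal_smul₀
      (integrable_of_continuousOn (hν.ae_mem hc) hcont).aemeasurable.ennreal_ofReal
      (Eventually.of_forall fun x => ENNReal.ofReal_lt_top)]
    refine integral_congr_ae ?_
    filter_upwards [hν.ae_mem hc] with x hx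
    rw [ENNReal.toReal_ofReal (eigfun_pos_of_mem hc hl hx).le, smul_eq_mul]
  rw [hdens, hdens]
  have h1 := hν.eigen (fun x => eigfun c l x * g x) (by
    rw [realJuliaSet_eq_trapped hc]; exact hcont.mul hg)
  have h2 : ∫ x, eigfun c l x * weightedMean c l g x ∂ν =
      ∫ x, l * ruelle c (fun x => eigfun c l x * g x) x ∂ν := by
    refine integral_congr_ae ?_
    filter_upwards [hν.ae_mem hc] with x hx
    have h0 := abs_le_of_mem_trapped hx
    have hcx := lt_of_abs_le hc h0
    have h3 := (eigfun_pos_of_mem hc hl hx).ne'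
    have h4 : x - c ≠ 0 := by linarith
    rw [ruelle_apply hcx, weightedMean, eigfun_root_add hc hl hsum h0, smul_eq_mul]
    field_simp
  rw [h2, integral_const_mul, h1, mul_inv_cancel_left₀ hl.ne']

end IsExplicitGibbs

lemma asymmetry_nonneg (hc : c < -2) (hl : 0 < l) (hsum : HasSum (coef c l) 1) {x : ℝ}
    (hx : x ∈ trapped c) : 0 ≤ asymmetry c l x := by
  have h1 := eigfun_le_eigfun_neg hc hl hsum (root_nonneg c x)
    (root_le_fixPt hc.le (trapped_subset_Icc c hx).2)
  exact div_nonneg (by linarith) (add_pos (eigfun_pos_of_mem hc hl (root_mem_trapped hc hx))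
    (eigfun_pos_of_mem hc hl (neg_root_mem_trapped hc hx))).le

lemma asymmetry_le_one (hc : c < -2) (hl : 0 < l) {x : ℝ} (hx : x ∈ trapped c) :
    asymmetry c l x ≤ 1 := by
  have h1 := eigfun_pos_of_mem hc hl (root_mem_trapped hc hx)
  have h2 := eigfun_pos_of_mem hc hl (neg_root_mem_trapped hc hx)
  rw [asymmetry, div_le_one (add_pos h1 h2)]
  linarith

lemma abs_weightedMean_sub_halfMean_le (hc : c < -2) (hl : 0 < l) (hsum : HasSum (coef c l) 1)
    {g : ℝ → ℝ} {B : ℝ} (hg : ∀ x, |g x| ≤ B) {x : ℝ} (hx : x ∈ trapped c) :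
    |weightedMean c l g x - halfMean c g x| ≤ B * asymmetry c l x := by
  have h1 := eigfun_pos_of_mem hc hl (root_mem_trapped hc hx)
  have h2 := eigfun_pos_of_mem hc hl (neg_root_mem_trapped hc hx)
  have h3 : weightedMean c l g x - halfMean c g x =
      asymmetry c l x * ((g (-root c x) - g (root c x)) / 2) := by
    have := (add_pos h1 h2).ne'
    rw [weightedMean, halfMean, asymmetry]
    field_simp
    ring
  rw [h3, abs_mul, abs_of_nonneg (asymmetry_nonneg hc hl hsum hx), mul_comm]
  refine mul_le_mul_of_nonneg_right ?_ (asymmetry_nonneg hc hl hsum hx)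
  have h4 := abs_le.1 (hg (root c x))
  have h5 := abs_le.1 (hg (-root c x))
  exact abs_le.2 ⟨by linarith, by linarith⟩

/-! ### No concentration at the fixed point -/

/-- The indicator function of the points whose first `m` iterates, starting with the point itself,
are positive; on the Julia set these are the points of a neighbourhood of `β`. -/
noncomputable def posOrbit (c : ℝ) : ℕ → ℝ → ℝ
  | 0, _ => 1
  | m + 1, x => (if 0 < x then 1 else 0) * posOrbit c m (quad c x)

lemma posOrbit_eq_zero_or_one (c : ℝ) (m : ℕ) (x : ℝ) :
    posOrbit c m x = 0 ∨ posOrbit c m x = 1 := by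
  induction m generalizing x with
  | zero => exact Or.inr rfl
  | succ m ih =>
    rw [posOrbit]
    split_ifs
    · simpa using ih (quad c x)
    · simp

lemma continuousOn_posOrbit (hc : c < -2) (m : ℕ) :
    ContinuousOn (posOrbit c m) (trapped c) := by
  induction m with
  | zero => exact continuousOn_const
  | succ m ih =>
    refine ContinuousOn.mul (fun x hx => ContinuousAt.continuousWithinAt ?_)
      (ih.comp (continuous_quad c).continuousOn fun x hx => quad_mem_trapped hx)
    rcases lt_trichotomy x 0 with h | rfl | h
    · refine continuousAt_const.congr (f := fun _ => 0) ?_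
      filter_upwards [Iio_mem_nhds h] with y hy using (if_neg (not_lt.2 (le_of_lt hy))).symm
    · have h1 := lt_of_abs_le hc (abs_le_of_mem_trapped (quad_mem_trapped hx))
      simp [quad] at h1
    · refine continuousAt_const.congr (f := fun _ => 1) ?_
      filter_upwards [Ioi_mem_nhds h] with y hy using (if_pos hy).symm

/-- As the positive branch has weight at most `1 / 2`, the neighbourhoods of `β` shrink in measure at
least by a factor `1 / 2`, uniformly in `c`. -/
lemma IsExplicitGibbs.integral_posOrbit_le (h : IsExplicitGibbs c l σ) (m : ℕ) :
    ∫ x, posOrbit c m x ∂σ ≤ (1 / 2) ^ m := by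
  have hc := h.lt
  have hl := h.pos
  have := h.prob
  induction m with
  | zero => simp [posOrbit]
  | succ m ih =>
    rw [← h.integral_weightedMean (continuousOn_posOrbit hc (m + 1)), pow_succ']
    refine le_trans ?_ (mul_le_mul_of_nonneg_left ih (by norm_num))
    rw [← integral_const_mul]
    refine integral_mono_ae
      (h.integrable (continuousOn_weightedMean hc hl (continuousOn_posOrbit hc (m + 1))))
      (h.integrable (continuousOn_const.mul (continuousOn_posOrbit hc m))) ?_
    filter_upwards [h.ae_mem] with x hx
    have hcx := lt_of_abs_le hc (abs_le_of_mem_trapped hx)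
    have h1 := eigfun_pos_of_mem hc hl (root_mem_trapped hc hx)
    have h2 := eigfun_pos_of_mem hc hl (neg_root_mem_trapped hc hx)
    have h3 := eigfun_le_eigfun_neg hc hl h.hasSum (root_nonneg c x)
      (root_le_fixPt hc.le (trapped_subset_Icc c hx).2)
    have h4 := root_pos hcx
    have h5 : 0 ≤ posOrbit c m x := by
      rcases posOrbit_eq_zero_or_one c m x with h | h <;> rw [h]
      exact zero_le_one
    rw [weightedMean, posOrbit, posOrbit, if_pos h4, if_neg (by linarith), quad_root hcx.le,
      one_mul, zero_mul, mul_zero, add_zero, div_le_iff₀ (by linarith)]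
    nlinarith

lemma le_sub_of_posOrbit_eq_zero (hc : c ≤ -2) (hβ : fixPt c ≤ 3) (m : ℕ) {x : ℝ}
    (hx : x ∈ trapped c) (h : posOrbit c m x = 0) : 2 / 6 ^ m ≤ fixPt c - x := by
  have h2 := two_le_fixPt hc
  induction m generalizing x with
  | zero => exact absurd h one_ne_zero
  | succ m ih =>
    rw [pow_succ, ← div_div, div_le_iff₀ (by norm_num)]
    rcases le_or_gt x 0 with h0 | h0
    · have : (2 : ℝ) / 6 ^ m ≤ 2 := div_le_self zero_le_two (one_le_pow₀ (by norm_num))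
      linarith
    · rw [posOrbit, if_pos h0, one_mul] at h
      refine (ih (quad_mem_trapped hx) h).trans ?_
      have h3 := (trapped_subset_Icc c hx).2
      have h4 := fixPt_sq hc
      rw [quad]
      nlinarith

/-- Near `β` the asymmetry is at most `1` on a set of small measure, and elsewhere the explicit form of
the eigenfunction bounds it. -/
lemma IsExplicitGibbs.integral_asymmetry_le (h : IsExplicitGibbs c l σ) (hβ : fixPt c ≤ 3)
    (m : ℕ) : ∫ x, asymmetry c l x ∂σ ≤ (1 / 2) ^ m + asymBound c l (2 / 6 ^ m) := by
  have hc := h.lt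
  have hl := h.pos
  have := h.prob
  have hδ : (0 : ℝ) < 2 / 6 ^ m := by positivity
  have hb := asymBound_nonneg hc.le hl hδ
  have h1 : ∫ x, asymmetry c l x ∂σ ≤ ∫ x, (posOrbit c m x + asymBound c l (2 / 6 ^ m)) ∂σ := by
    refine integral_mono_ae (h.integrable (continuousOn_asymmetry hc hl))
      (h.integrable ((continuousOn_posOrbit hc m).add continuousOn_const)) ?_
    filter_upwards [h.ae_mem] with x hx
    rcases posOrbit_eq_zero_or_one c m x with h0 | h0
    · have h1 := le_sub_of_posOrbit_eq_zero hc.le hβ m hx h0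
      have h2 := eigfun_pos_of_mem hc hl (root_mem_trapped hc hx)
      have h3 := eigfun_pos_of_mem hc hl (neg_root_mem_trapped hc hx)
      have hcx := lt_of_abs_le hc (abs_le_of_mem_trapped hx)
      have h4 := eigfun_neg_sub_le hc hl h.hasSum (root_nonneg c x)
        (root_le_fixPt hc.le (trapped_subset_Icc c hx).2) hδ (by
          have h5 := neg_le_critOrbit hc.le 0
          rw [critOrbit_zero] at h5
          rw [root_sq hcx.le]
          linarith [lt_neg_fixPt hc])
      rw [h0, zero_add, asymmetry, div_le_iff₀ (by linarith), mul_comm]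
      exact h4
    · rw [h0]
      linarith [asymmetry_le_one hc hl hx]
  refine h1.trans ?_
  rw [integral_add (h.integrable (continuousOn_posOrbit hc m)) (integrable_const _)]
  have := h.integral_posOrbit_le m
  simpa using this

/-! ### The asymmetry vanishes in the limit -/

lemma continuous_critOrbit (k : ℕ) : Continuous fun c => critOrbit c k := by
  induction k with
  | zero => simp_rw [critOrbit_zero]; fun_prop
  | succ k ih => simp_rw [critOrbit_succ]; fun_prop

lemma critOrbit_neg_two (k : ℕ) : critOrbit (-2) k = 2 := by
  induction k with
  | zero => rw [critOrbit_zero]; norm_num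
  | succ k ih => rw [critOrbit_succ, ih]; norm_num

/-- For `c` near `-2` already the first two terms of `∑ coef c 3 k` add up to more than `1`. -/
lemma eventually_lt_three : ∀ᶠ c in 𝓝[<] (-2 : ℝ), ∀ l, 0 < l → HasSum (coef c l) 1 → l < 3 := by
  have h1 : Tendsto (fun c : ℝ => 3 / (-2 * c) + 3 / (-2 * c) * (3 / (2 * (c ^ 2 + c))))
      (𝓝[<] (-2)) (𝓝 (3 / (-2 * (-2)) + 3 / (-2 * (-2)) * (3 / (2 * ((-2) ^ 2 + -2))))) := by
    refine ContinuousAt.tendsto ?_ |>.mono_left nhdsWithin_le_nhds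
    have h2 : (-2 : ℝ) * -2 ≠ 0 := by norm_num
    have h3 : (2 : ℝ) * ((-2) ^ 2 + -2) ≠ 0 := by norm_num
    fun_prop (disch := assumption)
  filter_upwards [h1.eventually_const_lt (show (1 : ℝ) < _ by norm_num), self_mem_nhdsWithin]
    with c hc hc2 l hl hsum
  by_contra! h3
  have hc2' : c < -2 := hc2
  have h4 := hsum.summable.sum_le_tsum (Finset.range 2) fun k _ => (coef_pos hc2'.le hl k).le
  rw [hsum.tsum_eq, Finset.sum_range_succ, Finset.sum_range_one] at h4
  simp only [coef, critOrbit_zero] at h4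
  have h5 : 0 < c ^ 2 + c := by nlinarith
  have h6 : 0 < -2 * c := by linarith
  have h7 : 3 / (-2 * c) + 3 / (-2 * c) * (3 / (2 * (c ^ 2 + c))) ≤
      l / (-2 * c) + l / (-2 * c) * (l / (2 * (c ^ 2 + c))) := by gcongr
  linarith

lemma coef_le_pow (hc : c ≤ -2) (hl : 0 < l) (hl3 : l ≤ 3) (k : ℕ) :
    coef c l k ≤ (3 / 4) ^ (k + 1) := by
  induction k with
  | zero =>
    rw [coef, zero_add, pow_one]
    exact div_le_div₀ (by norm_num) hl3 (by norm_num) (by linarith)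
  | succ k ih =>
    rw [coef, pow_succ _ (k + 1)]
    have h1 := neg_le_critOrbit hc k
    refine mul_le_mul ih ?_ (div_nonneg hl.le (by linarith)) (by positivity)
    exact div_le_div₀ (by norm_num) hl3 (by norm_num) (by linarith)

lemma tendsto_asymBound {l : ℝ → ℝ} (hl : ∀ c < -2, 0 < l c)
    (hsum : ∀ c < -2, HasSum (coef c (l c)) 1) {δ : ℝ} (hδ : 0 < δ) :
    Tendsto (fun c => asymBound c (l c) δ) (𝓝[<] (-2)) (𝓝 0) := by
  rw [← tsum_zero (α := ℝ) (β := ℕ)]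
  have hbd : ∀ᶠ c in 𝓝[<] (-2 : ℝ), c < -2 ∧ ∀ k, coef c (l c) k ≤ (3 / 4) ^ (k + 1) := by
    filter_upwards [eventually_lt_three, self_mem_nhdsWithin] with c hc hc2
    exact ⟨hc2, coef_le_pow (le_of_lt hc2) (hl c hc2) (hc _ (hl c hc2) (hsum c hc2)).le⟩
  refine tendsto_tsum_of_dominated_convergence (bound := fun k => (3 / 4 : ℝ) ^ (k + 1)) ?_ ?_ ?_
  · exact (summable_nat_add_iff 1).2 (summable_geometric_of_lt_one (by norm_num) (by norm_num))
  · intro k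
    have h1 : Tendsto (fun c => (critOrbit c k ^ 2 - c ^ 2) / δ) (𝓝[<] (-2)) (𝓝 0) := by
      have h2 : Continuous fun c => (critOrbit c k ^ 2 - c ^ 2) / δ := by
        have := continuous_critOrbit k
        fun_prop
      have h3 := h2.tendsto (-2)
      rw [critOrbit_neg_two] at h3
      norm_num at h3
      exact h3.mono_left nhdsWithin_le_nhds
    refine squeeze_zero' ?_ ?_ h1
    · filter_upwards [hbd] with c hc
      exact coef_mul_min_nonneg hc.1.le (hl c hc.1) hδ k
    · filter_upwards [hbd] with c hc
      have h4 := sq_le_critOrbit_sq hc.1.le k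
      have h5 : 0 ≤ (critOrbit c k ^ 2 - c ^ 2) / δ := div_nonneg (by linarith) hδ.le
      have h6 : coef c (l c) k ≤ 1 := (hc.2 k).trans (pow_le_one₀ (by norm_num) (by norm_num))
      have h7 := (coef_pos hc.1.le (hl c hc.1) k).le
      calc _ ≤ 1 * ((critOrbit c k ^ 2 - c ^ 2) / δ) := by
            refine mul_le_mul h6 (min_le_right _ _) (le_min zero_le_one h5) zero_le_one
        _ = _ := one_mul _
  · filter_upwards [hbd] with c hc k
    rw [Real.norm_of_nonneg (coef_mul_min_nonneg hc.1.le (hl c hc.1) hδ k)]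
    exact (coef_mul_min_le hc.1.le (hl c hc.1) δ k).trans (hc.2 k)

lemma fixPt_neg_two : fixPt (-2) = 2 := by
  rw [fixPt, show (1 - 4 * (-2) : ℝ) = 3 ^ 2 by norm_num, Real.sqrt_sq (by norm_num)]
  norm_num

lemma eventually_fixPt_le_three : ∀ᶠ c in 𝓝[<] (-2 : ℝ), fixPt c ≤ 3 := by
  have h1 : Tendsto fixPt (𝓝[<] (-2)) (𝓝 (fixPt (-2))) := by
    have : Continuous fixPt := by unfold fixPt; fun_prop
    exact (this.tendsto _).mono_left nhdsWithin_le_nhds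
  filter_upwards [h1.eventually_lt_const (show fixPt (-2) < 3 by rw [fixPt_neg_two]; norm_num)] with c hc
    using hc.le

lemma tendsto_integral_asymmetry {l : ℝ → ℝ} {σ : ℝ → Measure ℝ}
    (h : ∀ c < -2, IsExplicitGibbs c (l c) (σ c)) :
    Tendsto (fun c => ∫ x, asymmetry c (l c) x ∂(σ c)) (𝓝[<] (-2)) (𝓝 0) := by
  refine tendsto_order.2 ⟨fun a ha => ?_, fun ε hε => ?_⟩
  · filter_upwards [self_mem_nhdsWithin] with c hc
    have hg := h c hc
    refine ha.trans_le (integral_nonneg_of_ae ?_)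
    filter_upwards [hg.ae_mem] with x hx using asymmetry_nonneg hg.lt hg.pos hg.hasSum hx
  · obtain ⟨m, hm⟩ := exists_pow_lt_of_lt_one (half_pos hε) (show (1 / 2 : ℝ) < 1 by norm_num)
    filter_upwards [self_mem_nhdsWithin, eventually_fixPt_le_three,
      (tendsto_asymBound (fun c hc => (h c hc).pos) (fun c hc => (h c hc).hasSum)
        (show (0 : ℝ) < 2 / 6 ^ m by positivity)).eventually_lt_const (half_pos hε)] with c h1 h2 h3
    linarith [(h c h1).integral_asymmetry_le h2 m]

/-! ### Iterating the unweighted mean -/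

lemma abs_halfMean_le {g : ℝ → ℝ} {B : ℝ} (hg : ∀ x, |g x| ≤ B) (x : ℝ) :
    |halfMean c g x| ≤ B := by
  have h4 := abs_le.1 (hg (root c x))
  have h5 := abs_le.1 (hg (-root c x))
  exact abs_le.2 ⟨by rw [halfMean]; linarith, by rw [halfMean]; linarith⟩

lemma abs_iterate_halfMean_le {g : ℝ → ℝ} {B : ℝ} (hg : ∀ x, |g x| ≤ B) (n : ℕ) (x : ℝ) :
    |(halfMean c)^[n] g x| ≤ B := by
  induction n generalizing g with
  | zero => exact hg x
  | succ n ih => exact ih (abs_halfMean_le hg)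

lemma IsExplicitGibbs.abs_integral_sub_iterate_le (h : IsExplicitGibbs c l σ) {B : ℝ} (n : ℕ) :
    ∀ {g : ℝ → ℝ}, Continuous g → (∀ x, |g x| ≤ B) →
      |∫ x, g x ∂σ - ∫ x, (halfMean c)^[n] g x ∂σ| ≤ n * (B * ∫ x, asymmetry c l x ∂σ) := by
  have hc := h.lt
  have hl := h.pos
  induction n with
  | zero => intro g _ _; simp
  | succ n ih =>
    intro g hg hB
    have h1 := ih (continuous_halfMean c hg) (abs_halfMean_le hB)
    have h2 : |∫ x, g x ∂σ - ∫ x, halfMean c g x ∂σ| ≤ B * ∫ x, asymmetry c l x ∂σ := by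
      rw [← h.integral_weightedMean hg.continuousOn,
        ← integral_sub (h.integrable (continuousOn_weightedMean hc hl hg.continuousOn))
          (h.integrable (continuous_halfMean c hg).continuousOn), ← integral_const_mul]
      rw [← Real.norm_eq_abs]
      refine norm_integral_le_of_norm_le
        ((h.integrable (continuousOn_asymmetry hc hl)).const_mul B) ?_
      filter_upwards [h.ae_mem] with x hx
      exact abs_weightedMean_sub_halfMean_le hc hl h.hasSum hB hx
    rw [Function.iterate_succ_apply]
    refine (abs_sub_le _ (∫ x, halfMean c g x ∂σ) _).trans ?_
    push_cast
    linarith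

/-- The contraction of the inverse branches makes iterated means nearly constant. -/
lemma abs_iterate_halfMean_sub_le (hc : c ≤ -2) {ε : ℝ} (n : ℕ) :
    ∀ {g : ℝ → ℝ}, (∀ x y, |x| ≤ fixPt c → |y| ≤ fixPt c → angleDist c x y ≤ Real.pi / 2 ^ n →
      |g x - g y| ≤ ε) → ∀ x y, |x| ≤ fixPt c → |y| ≤ fixPt c →
      |(halfMean c)^[n] g x - (halfMean c)^[n] g y| ≤ ε := by
  have hr (x : ℝ) (hx : |x| ≤ fixPt c) : |root c x| ≤ fixPt c := by
    rw [abs_of_nonneg (root_nonneg _ _)]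
    exact root_le_fixPt hc (abs_le.1 hx).2
  induction n with
  | zero => exact fun h x y hx hy => h x y hx hy (by simpa using angleDist_le_pi c x y)
  | succ n ih =>
    intro g h x y hx hy
    rw [Function.iterate_succ_apply]
    refine ih (fun x y hx hy hxy => ?_) x y hx hy
    have hd : angleDist c (root c x) (root c y) ≤ Real.pi / 2 ^ (n + 1) := by
      rw [pow_succ, ← div_div]
      linarith [angleDist_root_le hc hx hy]
    have h1 := abs_le.1 (h _ _ (hr x hx) (hr y hy) hd)
    have h2 := abs_le.1 (h _ _ (by rw [abs_neg]; exact hr x hx) (by rw [abs_neg]; exact hr y hy)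
      (by rwa [angleDist_neg]))
    exact abs_le.2 ⟨by rw [halfMean, halfMean]; linarith, by rw [halfMean, halfMean]; linarith⟩

/-- The number of iterations that makes the mean nearly constant is uniform in `c`. -/
lemma exists_iterate_halfMean_near {g : ℝ → ℝ} (hg : Continuous g) {ε : ℝ} (hε : 0 < ε) :
    ∃ n : ℕ, ∀ c ≤ -2, fixPt c ≤ 3 → ∀ x y, |x| ≤ fixPt c → |y| ≤ fixPt c →
      |(halfMean c)^[n] g x - (halfMean c)^[n] g y| ≤ ε := by
  have hu := isCompact_Icc.uniformContinuousOn_of_continuous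
    (hg.continuousOn (s := Set.Icc (-3) 3))
  obtain ⟨δ, hδ, hδg⟩ := Metric.uniformContinuousOn_iff.1 hu ε hε
  obtain ⟨n, hn⟩ := pow_unbounded_of_one_lt (3 * Real.pi / δ) (one_lt_two (α := ℝ))
  refine ⟨n, fun c hc hβ => abs_iterate_halfMean_sub_le hc n fun x y hx hy hxy => ?_⟩
  refine (hδg x (abs_le.1 (hx.trans hβ)) y (abs_le.1 (hy.trans hβ)) ?_).le
  rw [Real.dist_eq]
  refine (abs_sub_le_angleDist hc hx hy).trans_lt ?_
  rw [div_lt_iff₀ hδ] at hn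
  calc _ ≤ 3 * (Real.pi / 2 ^ n) := mul_le_mul hβ hxy (abs_nonneg _) (by norm_num)
    _ = 3 * Real.pi / 2 ^ n := by ring
    _ < δ := by rw [div_lt_iff₀ (by positivity)]; linarith

lemma continuous_iterate_halfMean {g : ℝ → ℝ} (hg : Continuous g) (n : ℕ) :
    Continuous fun p : ℝ × ℝ => (halfMean p.1)^[n] g p.2 := by
  induction n with
  | zero => exact hg.comp continuous_snd
  | succ n ih =>
    simp_rw [Function.iterate_succ_apply']
    have h1 : Continuous fun p : ℝ × ℝ => root p.1 p.2 := by unfold root; fun_prop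
    have h2 := ih.comp (continuous_fst.prodMk h1)
    have h3 := ih.comp (continuous_fst.prodMk h1.neg)
    exact (h2.add h3).div_const 2

/-! ### The arcsine measure -/

lemma coe_arcsineMeasure : (arcsineMeasure : Measure ℝ) =
    (volume.restrict (Set.Icc (0 : ℝ) 1)).map fun t => 2 * Real.cos (Real.pi * t) := rfl

lemma image_two_mul_cos_Ioo :
    (fun t : ℝ => 2 * Real.cos (Real.pi * t)) '' Set.Ioo 0 1 = Set.Ioo (-2) 2 := by
  have hπ := Real.pi_pos
  ext x
  constructor
  · rintro ⟨t, ⟨ht0, ht1⟩, rfl⟩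
    have h1 := Real.cos_lt_cos_of_nonneg_of_le_pi le_rfl (by nlinarith)
      (show 0 < Real.pi * t by positivity)
    have h2 := Real.cos_lt_cos_of_nonneg_of_le_pi (show 0 ≤ Real.pi * t by positivity) le_rfl
      (by nlinarith)
    rw [Real.cos_zero] at h1
    rw [Real.cos_pi] at h2
    constructor <;> linarith
  · rintro ⟨h1, h2⟩
    refine ⟨Real.arccos (x / 2) / Real.pi, ⟨div_pos (Real.arccos_pos.2 (by linarith)) hπ, ?_⟩, ?_⟩
    · rw [div_lt_one hπ]
      refine (Real.arccos_le_pi _).lt_of_ne fun h => ?_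
      rw [Real.arccos_eq_pi] at h
      linarith
    · simp only
      rw [mul_div_cancel₀ _ hπ.ne', Real.cos_arccos (by linarith) (by linarith)]
      ring

theorem arcsineMeasure_eq_withDensity : (arcsineMeasure : Measure ℝ) =
    (volume.restrict (Set.Icc (-2 : ℝ) 2)).withDensity
      (fun x => ENNReal.ofReal (1 / (Real.pi * Real.sqrt (4 - x ^ 2)))) := by
  have hπ := Real.pi_pos
  set ρ : ℝ → ENNReal := fun x => ENNReal.ofReal (1 / (Real.pi * Real.sqrt (4 - x ^ 2))) with hρ
  have hφ : Measurable fun t : ℝ => 2 * Real.cos (Real.pi * t) := by fun_prop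
  have hd (t : ℝ) : HasDerivAt (fun t : ℝ => 2 * Real.cos (Real.pi * t))
      (2 * (-Real.sin (Real.pi * t) * Real.pi)) t := by
    have h1 : HasDerivAt (fun t => Real.pi * t) Real.pi t := by
      simpa using (hasDerivAt_id t).const_mul Real.pi
    exact h1.cos.const_mul 2
  have hinj : Set.InjOn (fun t : ℝ => 2 * Real.cos (Real.pi * t)) (Set.Ioo 0 1) := by
    intro s hs t ht hst
    have h1 : Real.cos (Real.pi * s) = Real.cos (Real.pi * t) := by
      simpa using hst
    have h2 := Real.injOn_cos (x₁ := Real.pi * s) (x₂ := Real.pi * t)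
      ⟨by have := hs.1; positivity, by have := hs.2; nlinarith⟩
      ⟨by have := ht.1; positivity, by have := ht.2; nlinarith⟩ h1
    exact mul_left_cancel₀ hπ.ne' h2
  ext s hs
  have key := lintegral_image_eq_lintegral_abs_deriv_mul measurableSet_Ioo
    (fun t _ => (hd t).hasDerivWithinAt) hinj (s.indicator ρ)
  rw [image_two_mul_cos_Ioo] at key
  rw [coe_arcsineMeasure, Measure.map_apply hφ hs, withDensity_apply _ hs,
    ← lintegral_indicator hs, ← restrict_Ioo_eq_restrict_Icc, ← restrict_Ioo_eq_restrict_Icc, key,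
    ← lintegral_indicator_one (hφ hs)]
  refine setLIntegral_congr_fun measurableSet_Ioo fun t ht => ?_
  by_cases hts : 2 * Real.cos (Real.pi * t) ∈ s
  · have hsin : 0 < Real.sin (Real.pi * t) :=
      Real.sin_pos_of_pos_of_lt_pi (by have := ht.1; positivity) (by have := ht.2; nlinarith)
    have h1 : √(4 - (2 * Real.cos (Real.pi * t)) ^ 2) = 2 * Real.sin (Real.pi * t) := by
      rw [show 4 - (2 * Real.cos (Real.pi * t)) ^ 2 = (2 * Real.sin (Real.pi * t)) ^ 2 by
        have := Real.sin_sq_add_cos_sq (Real.pi * t)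
        linear_combination -4 * this]
      exact Real.sqrt_sq (by linarith)
    rw [Set.indicator_of_mem (show t ∈ (fun t : ℝ => 2 * Real.cos (Real.pi * t)) ⁻¹' s from hts), Set.indicator_of_mem hts, hρ]
    simp only
    rw [h1, ← ENNReal.ofReal_mul (abs_nonneg _), Pi.one_apply, eq_comm, ENNReal.ofReal_eq_one,
      show 2 * (-Real.sin (Real.pi * t) * Real.pi) = -(2 * (Real.sin (Real.pi * t) * Real.pi)) by
        ring, abs_neg, abs_of_pos (by positivity)]
    field_simp
  · rw [Set.indicator_of_notMem (show t ∉ (fun t : ℝ => 2 * Real.cos (Real.pi * t)) ⁻¹' s from hts), Set.indicator_of_notMem hts, mul_zero]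

lemma integral_arcsineMeasure {g : ℝ → ℝ} (hg : Continuous g) :
    ∫ x, g x ∂(arcsineMeasure : Measure ℝ) =
      ∫ t in (0 : ℝ)..1, g (2 * Real.cos (Real.pi * t)) := by
  rw [coe_arcsineMeasure, integral_map (by fun_prop) hg.aestronglyMeasurable,
    integral_Icc_eq_integral_Ioc, intervalIntegral.integral_of_le zero_le_one]

lemma ae_mem_arcsineMeasure : ∀ᵐ x ∂(arcsineMeasure : Measure ℝ), |x| ≤ 2 := by
  rw [coe_arcsineMeasure]
  refine (ae_map_iff (by fun_prop) (measurableSet_le (by fun_prop) (by fun_prop))).2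
    (Eventually.of_forall fun t => ?_)
  rw [abs_mul, abs_two]
  linarith [Real.abs_cos_le_one (Real.pi * t)]

lemma root_neg_two {t : ℝ} (ht : t ∈ Set.Icc (0 : ℝ) 1) :
    root (-2) (2 * Real.cos (Real.pi * t)) = 2 * Real.cos (Real.pi * (t / 2)) := by
  have hπ := Real.pi_pos
  have h1 : 0 ≤ Real.cos (Real.pi * (t / 2)) :=
    Real.cos_nonneg_of_neg_pi_div_two_le_of_le (by nlinarith [ht.1]) (by nlinarith [ht.2])
  have h2 := Real.cos_sq (Real.pi * (t / 2))
  rw [show 2 * (Real.pi * (t / 2)) = Real.pi * t by ring] at h2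
  rw [root, show 2 * Real.cos (Real.pi * t) - -2 = (2 * Real.cos (Real.pi * (t / 2))) ^ 2 by
    linear_combination -4 * h2]
  exact Real.sqrt_sq (by linarith)

/-- In the angular coordinate the two inverse branches of `x ^ 2 - 2` are `t / 2` and
`1 - t / 2`. -/
lemma integral_halfMean_arcsineMeasure {g : ℝ → ℝ} (hg : Continuous g) :
    ∫ x, halfMean (-2) g x ∂(arcsineMeasure : Measure ℝ) =
      ∫ x, g x ∂(arcsineMeasure : Measure ℝ) := by
  rw [integral_arcsineMeasure (continuous_halfMean _ hg), integral_arcsineMeasure hg]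
  set F : ℝ → ℝ := fun t => g (2 * Real.cos (Real.pi * t)) with hF
  have hFc : Continuous F := by fun_prop
  have h1 : ∫ t in (0 : ℝ)..1, halfMean (-2) g (2 * Real.cos (Real.pi * t)) =
      ∫ t in (0 : ℝ)..1, (F (t / 2) / 2 + F (1 - t / 2) / 2) := by
    refine intervalIntegral.integral_congr fun t ht => ?_
    rw [Set.uIcc_of_le zero_le_one] at ht
    simp only [halfMean, hF]
    rw [root_neg_two ht, show Real.pi * (1 - t / 2) = Real.pi - Real.pi * (t / 2) by ring,
      Real.cos_pi_sub, mul_neg]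
    ring
  rw [h1, intervalIntegral.integral_add
    (Continuous.intervalIntegrable (by fun_prop) _ _)
    (Continuous.intervalIntegrable (by fun_prop) _ _),
    intervalIntegral.integral_div, intervalIntegral.integral_div,
    intervalIntegral.integral_comp_div F two_ne_zero,
    intervalIntegral.integral_comp_sub_div F two_ne_zero,
    ← intervalIntegral.integral_add_adjacent_intervals (b := 1 / 2)
      (hFc.intervalIntegrable 0 (1 / 2)) (hFc.intervalIntegrable _ 1)]
  norm_num

lemma integral_iterate_halfMean_arcsineMeasure {g : ℝ → ℝ} (hg : Continuous g) (n : ℕ) :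
    ∫ x, (halfMean (-2))^[n] g x ∂(arcsineMeasure : Measure ℝ) =
      ∫ x, g x ∂(arcsineMeasure : Measure ℝ) := by
  induction n generalizing g with
  | zero => rfl
  | succ n ih =>
    rw [Function.iterate_succ_apply, ih (continuous_halfMean _ hg),
      integral_halfMean_arcsineMeasure hg]

/-! ### Convergence -/

lemma abs_integral_sub_le_of_ae {μ : Measure ℝ} [IsProbabilityMeasure μ] {g : ℝ → ℝ} {a ε : ℝ}
    (hg : Integrable g μ) (h : ∀ᵐ x ∂μ, |g x - a| ≤ ε) : |∫ x, g x ∂μ - a| ≤ ε := by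
  have h1 : ∫ x, g x ∂μ - a = ∫ x, (g x - a) ∂μ := by
    rw [integral_sub hg (integrable_const a)]
    simp
  rw [h1, ← Real.norm_eq_abs]
  simpa using norm_integral_le_of_norm_le_const (μ := μ) (f := fun x => g x - a) h

/-- Compare `∫ g ∂σ_c`, `∫ Q_c ^ n g ∂σ_c`, `(Q_c ^ n g)(0)`, `(Q_{-2} ^ n g)(0)` and `∫ g` against
the arcsine measure, where `Q_c = halfMean c`: with `n` fixed first, consecutive terms are close for
`c` near `-2`. -/
theorem tendsto_integral_of_isExplicitGibbs {l : ℝ → ℝ} {σ : ℝ → Measure ℝ}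
    (h : ∀ c < -2, IsExplicitGibbs c (l c) (σ c)) {g : ℝ → ℝ} (hg : Continuous g) {B : ℝ}
    (hB : ∀ x, |g x| ≤ B) :
    Tendsto (fun c => ∫ x, g x ∂(σ c)) (𝓝[<] (-2))
      (𝓝 (∫ x, g x ∂(arcsineMeasure : Measure ℝ))) := by
  rw [Metric.tendsto_nhds]
  intro ε hε
  obtain ⟨n, hn⟩ := exists_iterate_halfMean_near hg (show 0 < ε / 5 by positivity)
  have hcont := continuous_iterate_halfMean hg n
  have h1 : Tendsto (fun c => (n : ℝ) * (B * ∫ x, asymmetry c (l c) x ∂(σ c))) (𝓝[<] (-2))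
      (𝓝 0) := by
    simpa using ((tendsto_integral_asymmetry h).const_mul B).const_mul (n : ℝ)
  have h2 : Tendsto (fun c => (halfMean c)^[n] g 0) (𝓝[<] (-2)) (𝓝 ((halfMean (-2))^[n] g 0)) :=
    ((hcont.comp (continuous_id.prodMk continuous_const)).tendsto (-2)).mono_left
      nhdsWithin_le_nhds
  have hβ2 := fixPt_neg_two
  have h3 : |∫ x, g x ∂(arcsineMeasure : Measure ℝ) - (halfMean (-2))^[n] g 0| ≤ ε / 5 := by
    rw [← integral_iterate_halfMean_arcsineMeasure hg n]
    have hc : Continuous ((halfMean (-2))^[n] g) :=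
      hcont.comp (continuous_const.prodMk continuous_id)
    refine abs_integral_sub_le_of_ae ?_ ?_
    · exact Integrable.of_bound hc.aestronglyMeasurable B
        (Eventually.of_forall fun x => abs_iterate_halfMean_le hB n x)
    · filter_upwards [ae_mem_arcsineMeasure] with x hx
      exact hn (-2) le_rfl (by rw [hβ2]; norm_num) x 0 (by rwa [hβ2]) (by rw [hβ2]; norm_num)
  filter_upwards [self_mem_nhdsWithin, eventually_fixPt_le_three,
    h1.eventually_lt_const (show 0 < ε / 5 by positivity),
    Metric.tendsto_nhds.1 h2 (ε / 5) (by positivity)] with c hc hβ h4 h5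
  have hc2 : c < -2 := hc
  have hG := h c hc
  have := hG.prob
  have h6 := hG.abs_integral_sub_iterate_le n hg hB
  have hcc : Continuous ((halfMean c)^[n] g) :=
    hcont.comp (continuous_const.prodMk continuous_id)
  have h7 : |∫ x, (halfMean c)^[n] g x ∂(σ c) - (halfMean c)^[n] g 0| ≤ ε / 5 := by
    refine abs_integral_sub_le_of_ae (hG.integrable hcc.continuousOn) ?_
    filter_upwards [hG.ae_mem] with x hx
    exact hn c hc2.le hβ x 0 (abs_le_of_mem_trapped hx)
      (by rw [abs_zero]; linarith [two_lt_fixPt hc2])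
  rw [Real.dist_eq] at h5 ⊢
  have e3 := abs_le.1 h3
  have e5 := abs_lt.1 h5
  have e6 := abs_le.1 h6
  have e7 := abs_le.1 h7
  exact abs_lt.2 ⟨by linarith, by linarith⟩

theorem tendsto_gibbsState {σ : ℝ → ProbabilityMeasure ℝ} (hσ : ∀ c < -2, IsGibbsState c (σ c)) :
    Tendsto σ (𝓝[<] (-2)) (𝓝 arcsineMeasure) := by
  choose! l hl hsum using fun (c : ℝ) (hc : c < -2) => exists_hasSum_coef hc
  refine ProbabilityMeasure.tendsto_iff_forall_integral_tendsto.2 fun g => ?_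
  exact tendsto_integral_of_isExplicitGibbs (l := l) (σ := fun c => (σ c : Measure ℝ))
    (fun c hc => ⟨hc, hl c hc, hsum c hc, inferInstance,
      (hσ c hc).exists_eigenmeasure hc (hl c hc) (hsum c hc)⟩)
    g.continuous fun x => g.norm_coe_le_norm x

end QuadraticGibbs

/-- For every `c < -2` there is exactly one Gibbs state `σ_c`; as `c → -2` from below it converges
weakly to `σ_{-2}`, which has density `1 / (π √(4 - x²))` on `[-2, 2]`. -/
theorem proposition1 :
    (∀ c : ℝ, c < -2 → ∃! σ : ProbabilityMeasure ℝ, QuadraticGibbs.IsGibbsState c σ) ∧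
    (QuadraticGibbs.arcsineMeasure : Measure ℝ) =
      (volume.restrict (Set.Icc (-2 : ℝ) 2)).withDensity
        (fun x => ENNReal.ofReal (1 / (Real.pi * Real.sqrt (4 - x ^ 2)))) ∧
    ∀ σ : ℝ → ProbabilityMeasure ℝ,
      (∀ c : ℝ, c < -2 → QuadraticGibbs.IsGibbsState c (σ c)) →
      Tendsto σ (𝓝[<] (-2 : ℝ)) (𝓝 QuadraticGibbs.arcsineMeasure) :=
  ⟨fun _ hc => QuadraticGibbs.existsUnique_isGibbsState hc,
    QuadraticGibbs.arcsineMeasure_eq_withDensity,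
    fun _ hσ => QuadraticGibbs.tendsto_gibbsState hσ⟩
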